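/- **Conventions.** Simplicial complexes are finite and include the empty simplex. Chains have complex coefficients, all homology is reduced and is taken with respect to the usual (unweighted) simplicial boundary, and $H_k$ is spanned by classes of $k$-cycles ($H_{-1}$ included). Fix vertex weights $w>0$ and put on chains the inner product in which the simplices are orthogonal with $\|\sigma\|=\prod_{v\in\sigma}w(v)$. With $d$ the (weight-independent) simplicial coboundary and $\partial=d^\dagger$, the Laplacian is $\Delta=d\partial+\partial d$, and $\Delta_k$ is its restriction to $k$-chains. The Witten index is the number of bosonic minus the number of fermionic zero-energy states, $\sum_{p\ge 0}(-1)^p\dim\ker\Delta_{p-1}$, where a $k$-simplex consists of $p=k+1$ fermions. The reduced Euler characteristic is $\tilde\chi=\sum_\sigma(-1)^{\dim\sigma}$ with $\dim\emptyset=-1$. **Qubit complex.** Let $\mathcal G_1$ be the bowtie graph on the vertices $x,a_2,a_3,a_4,b_2,b_3,b_4$, whose edges are those of the two square loops $x a_3 a_2 a_4 x$ (for the bit $0$) and $x b_3 b_2 b_4 x$ (for the bit $1$). Let $\mathcal G_m$ be the join of $m$ copies of $\mathcal G_1$, and $\mathrm{Cl}(\mathcal G_m)$ its clique complex. For $z\in\{0,1\}^m$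 let $|z\rangle\in C_{2m-1}(\mathrm{Cl}(\mathcal G_m))$ be the join $|z_1\rangle\otimes\dots\otimes|z_m\rangle$, where $|0\rangle=[xa_3]+[a_3a_2]+[a_2a_4]+[a_4x]$ and $|1\rangle=[xb_3]+[b_3b_2]+[b_2b_4]+[b_4x]$. Let $\mathcal J_z\subseteq\mathrm{Cl}(\mathcal G_m)$ be the subcomplex of all simplices all of whose vertices lie on the loops $z_1,\dots,z_m$ of the respective copies (the boundary of a $2m$-dimensional cross-polytope). **Gadget.** Fix any total order of the vertices. The thickening of $\mathcal J=\mathcal J_z$ is the complex on $\mathcal J^0\times\{0,1\}$ whose simplices are the sets $\{(u,0):u\in A\}\cup\{(v,1):v\in B\}$ with $A\cup B\in\mathcal J$ and $u\le v$ for all $u\in A$, $v\in B$. The gadget is obtained from it by coning off: a central vertex $v_0$ is added, together with the simplices $\{v_0\}\cup\tau$ for every (possibly empty) simplex $\tau$ of the inner layer $\mathcal J\times\{1\}$. Let $\hat{\mathcal K}_z$ be the complex obtained from $\mathrm{Cl}(\mathcal G_m)$ by gluing on the gadget along $\mathcal J\times\{0\}=\mathcal J$. The vertices of $\mathcal G_m$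 have weight $1$, and the vertices of the inner layer and $v_0$ have weight $\lambda$. **Theorem.** For every $m\ge 0$, every $z\in\{0,1\}^m$, every order of the vertices and every $\lambda>0$: 1. $\hat{\mathcal K}_z$ is the clique complex of a graph. 2. (The corresponding cycle is filled in.) For every $y\in\{0,1\}^m$ the chain $|y\rangle$ is a cycle. The class $[\,|z\rangle\,]$ is non-zero in $H_{2m-1}(\mathrm{Cl}(\mathcal G_m))$ and is mapped to $0$ in $H_{2m-1}(\hat{\mathcal K}_z)$ by the map $\iota_*$ induced by the inclusion $\iota:\mathrm{Cl}(\mathcal G_m)\subseteq\hat{\mathcal K}_z$. 3. (No other hole is filled in.) The kernel of $\iota_*$ on $H_{2m-1}$ is the line $\mathbb C\,[\,|z\rangle\,]$, and $\iota_*$ is injective on $H_k$ for every $k\ne 2m-1$. 4. (No new homology class is created.) $\iota_*:H_k(\mathrm{Cl}(\mathcal G_m))\to H_k(\hat{\mathcal K}_z)$ is surjective for every $k$. 5. (What remains.) $H_k(\hat{\mathcal K}_z)=0$ for $k\ne 2m-1$, and the $2^m-1$ classes $\iota_*[\,|y\rangle\,]$ with $y\in\{0,1\}^m$, $y\ne z$,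 form a basis of $H_{2m-1}(\hat{\mathcal K}_z)$. 6. The Witten index of $\hat{\mathcal K}_z$ with these weights is $2^m-1$. Equivalently, its reduced Euler characteristic is $\tilde\chi(\hat{\mathcal K}_z)=-(2^m-1)$; the sign is due to the holes being of odd dimension $2m-1$. -/

import Mathlib

noncomputable section

namespace CliqueGadget

open Finset

/-! ### Reduced simplicial homology over `ℂ`

Simplices are indexed by their number of vertices `p` (the number of fermions), so that `p = 0` is
the empty simplex and a simplex of dimension `k` has `p = k + 1` vertices. -/

section Homology

variable {V W : Type*}

/-- The simplices of `K` with exactly `p` vertices; the empty simplex is included. -/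
abbrev Simplex (K : PreAbstractSimplicialComplex V) (p : ℕ) : Type _ :=
  {s : Finset V // (s = ∅ ∨ s ∈ K.faces) ∧ s.card = p}

instance [Finite V] (K : PreAbstractSimplicialComplex V) (p : ℕ) : Fintype (Simplex K p) :=
  Fintype.ofFinite _

instance [Finite V] (K : PreAbstractSimplicialComplex V) (p : ℕ) : DecidableEq (Simplex K p) :=
  Classical.decEq _

/-- The space of chains supported on the simplices with `p` vertices. -/
abbrev Chain (K : PreAbstractSimplicialComplex V) (p : ℕ) : Type _ := Simplex K p → ℂ

theorem map_simplex {V W : Type*} [LinearOrder V] [LinearOrder W]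
    {K : PreAbstractSimplicialComplex V} {L : PreAbstractSimplicialComplex W} {e : V ↪o W} (h : ∀ s ∈ K.faces, s.map e.toEmbedding ∈ L.faces)
    {p : ℕ} (σ : Simplex K p) :
    (σ.1.map e.toEmbedding = ∅ ∨ σ.1.map e.toEmbedding ∈ L.faces) ∧
      (σ.1.map e.toEmbedding).card = p :=
  ⟨σ.2.1.imp (fun h0 => by rw [h0, Finset.map_empty]) (h _),
    by rw [Finset.card_map]; exact σ.2.2⟩

variable [LinearOrder V] [Finite V] [LinearOrder W] [Finite W]

/-- The boundary operator of the complex `K` with vertex weights `w`, from `p + 1` to `p` vertices,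
in the orthonormal basis of (increasingly oriented, normalised) simplices:
`∂ [v₀ … v_p] = ∑ i, (-1) ^ i w(v_i) [v₀ … v̂_i … v_p]`. -/
def boundaryMatrix (K : PreAbstractSimplicialComplex V) (w : V → ℝ) (p : ℕ) :
    Matrix (Simplex K p) (Simplex K (p + 1)) ℂ :=
  Matrix.of fun τ σ => ∑ v ∈ σ.1,
    if τ.1 = σ.1.erase v then (-1) ^ #{u ∈ σ.1 | u < v} * (w v : ℂ) else 0

/-- The usual (unweighted) boundary map from `p + 1` to `p` vertices. -/
def boundary (K : PreAbstractSimplicialComplex V) (p : ℕ) : Chain K (p + 1) →ₗ[ℂ] Chain K p :=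
  (boundaryMatrix K (fun _ => 1) p).mulVecLin

/-- Cycles. Every multiple of the empty simplex is a cycle. -/
def cycles (K : PreAbstractSimplicialComplex V) : (p : ℕ) → Submodule ℂ (Chain K p)
  | 0 => ⊤
  | p + 1 => LinearMap.ker (boundary K p)

def boundaries (K : PreAbstractSimplicialComplex V) (p : ℕ) : Submodule ℂ (Chain K p) :=
  LinearMap.range (boundary K p)

/-- Reduced homology; `Homology K p` is the homology in dimension `p - 1`. -/
abbrev Homology (K : PreAbstractSimplicialComplex V) (p : ℕ) : Type _ :=
  cycles K p ⧸ (boundaries K p).submoduleOf (cycles K p)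

/-- The homology class of a cycle. -/
def homologyClass (K : PreAbstractSimplicialComplex V) {p : ℕ} (c : Chain K p)
    (hc : c ∈ cycles K p) : Homology K p :=
  Submodule.Quotient.mk ⟨c, hc⟩

/-- The Laplacian `Δ = d ∂ + ∂ d` of the weighted complex on the simplices with `p` vertices,
where `d` is the adjoint of `∂`. -/
def laplacian (K : PreAbstractSimplicialComplex V) (w : V → ℝ) :
    (p : ℕ) → Matrix (Simplex K p) (Simplex K p) ℂ
  | 0 => boundaryMatrix K w 0 * (boundaryMatrix K w 0).conjTranspose
  | p + 1 => (boundaryMatrix K w p).conjTranspose * boundaryMatrix K w p +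
      boundaryMatrix K w (p + 1) * (boundaryMatrix K w (p + 1)).conjTranspose

/-- The Witten index: the number of bosonic (even fermion number) minus the number of fermionic
(odd fermion number) zero-energy states of the Laplacian. -/
def wittenIndex (K : PreAbstractSimplicialComplex V) (w : V → ℝ) : ℤ :=
  ∑ p ∈ range (Nat.card V + 1),
    (-1) ^ p * (Module.finrank ℂ (LinearMap.ker (laplacian K w p).mulVecLin) : ℤ)

/-- The reduced Euler characteristic `∑ σ, (-1) ^ dim σ`, where `dim ∅ = -1`: a simplex with `p`
vertices contributes `(-1) ^ (p - 1) = (-1) ^ (p + 1)`. -/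
def reducedEulerChar (K : PreAbstractSimplicialComplex V) : ℤ :=
  ∑ p ∈ range (Nat.card V + 1), (-1) ^ (p + 1) * (Nat.card (Simplex K p) : ℤ)

/-! The map on homology induced by an order preserving embedding of vertices. -/

/-- The matrix of the chain map `[v₀ … v_k] ↦ [e v₀ … e v_k]`. -/
def pushMatrix (K : PreAbstractSimplicialComplex V) (L : PreAbstractSimplicialComplex W)
    (e : V ↪o W) (p : ℕ) : Matrix (Simplex L p) (Simplex K p) ℂ :=
  Matrix.of fun τ σ => if τ.1 = σ.1.map e.toEmbedding then 1 else 0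

def push (K : PreAbstractSimplicialComplex V) (L : PreAbstractSimplicialComplex W)
    (e : V ↪o W) (p : ℕ) : Chain K p →ₗ[ℂ] Chain L p :=
  (pushMatrix K L e p).mulVecLin

variable {K : PreAbstractSimplicialComplex V} {L : PreAbstractSimplicialComplex W}

theorem boundary_comp_push {e : V ↪o W} (h : ∀ s ∈ K.faces, s.map e.toEmbedding ∈ L.faces)
    (p : ℕ) : boundary L p ∘ₗ push K L e (p + 1) = push K L e p ∘ₗ boundary K p := by
  rw [boundary, boundary, push, push, ← Matrix.mulVecLin_mul, ← Matrix.mulVecLin_mul]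
  congr 1
  ext τ σ
  have hcard (v : V) : #{u ∈ σ.1.map e.toEmbedding | u < e v} = #{u ∈ σ.1 | u < v} := by
    rw [Finset.filter_map, Finset.card_map]
    congr 1
    ext u
    simp
  have h1 : (boundaryMatrix L (fun _ => 1) p * pushMatrix K L e (p + 1)) τ σ =
      ∑ v ∈ σ.1, if τ.1 = (σ.1.erase v).map e.toEmbedding then
        (-1) ^ #{u ∈ σ.1 | u < v} else 0 := by
    rw [Matrix.mul_apply, Finset.sum_eq_single ⟨_, map_simplex h σ⟩]
    · simp only [boundaryMatrix, pushMatrix, Matrix.of_apply, if_true, mul_one,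
        Complex.ofReal_one, Finset.sum_map]
      refine Finset.sum_congr rfl fun v _ => ?_
      rw [Finset.map_erase]
      simp only [RelEmbedding.coe_toEmbedding, hcard]
    · intro ρ _ hρ
      have : ρ.1 ≠ σ.1.map e.toEmbedding := fun h' => hρ (Subtype.ext h')
      simp [pushMatrix, this]
    · simp
  have h2 : (pushMatrix K L e p * boundaryMatrix K (fun _ => 1) p) τ σ =
      ∑ v ∈ σ.1, if τ.1 = (σ.1.erase v).map e.toEmbedding then
        (-1) ^ #{u ∈ σ.1 | u < v} else 0 := by
    simp only [Matrix.mul_apply, boundaryMatrix, pushMatrix, Matrix.of_apply, Finset.mul_sum,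
      Complex.ofReal_one, mul_one]
    rw [Finset.sum_comm]
    refine Finset.sum_congr rfl fun v hv => ?_
    have hface : ((σ.1.erase v) = ∅ ∨ σ.1.erase v ∈ K.faces) ∧ (σ.1.erase v).card = p := by
      refine ⟨?_, by rw [Finset.card_erase_of_mem hv, σ.2.2, Nat.add_sub_cancel]⟩
      rcases (σ.1.erase v).eq_empty_or_nonempty with h0 | h0
      · exact Or.inl h0
      · rcases σ.2.1 with h' | h'
        · rw [h'] at hv
          simp at hv
        · exact Or.inr ((K.isRelLowerSet_faces h').2 (Finset.erase_subset _ _) h0)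
    rw [Finset.sum_eq_single ⟨_, hface⟩]
    · simp
    · intro ρ _ hρ
      have : ρ.1 ≠ σ.1.erase v := fun h' => hρ (Subtype.ext h')
      simp [this]
    · simp
  rw [h1, h2]

theorem push_mem_cycles {e : V ↪o W} (h : ∀ s ∈ K.faces, s.map e.toEmbedding ∈ L.faces)
    {p : ℕ} : cycles K p ≤ (cycles L p).comap (push K L e p) := by
  cases p with
  | zero => intro c _; trivial
  | succ p =>
    intro c hc
    have hc' : boundary K p c = 0 := hc
    have := LinearMap.congr_fun (boundary_comp_push h p) c
    simp only [LinearMap.comp_apply, hc', map_zero] at this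
    exact this

theorem push_mem_boundaries {e : V ↪o W} (h : ∀ s ∈ K.faces, s.map e.toEmbedding ∈ L.faces)
    {p : ℕ} : boundaries K p ≤ (boundaries L p).comap (push K L e p) := by
  rintro _ ⟨c, rfl⟩
  exact ⟨push K L e (p + 1) c, LinearMap.congr_fun (boundary_comp_push h p) c⟩

/-- The map induced on homology. -/
def homologyMap (K : PreAbstractSimplicialComplex V) (L : PreAbstractSimplicialComplex W)
    (e : V ↪o W) (h : ∀ s ∈ K.faces, s.map e.toEmbedding ∈ L.faces) (p : ℕ) :
    Homology K p →ₗ[ℂ] Homology L p :=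
  Submodule.mapQ _ _ ((push K L e p).restrict (push_mem_cycles h))
    (fun _ hc => push_mem_boundaries h hc)

end Homology

/-! ### Clique complexes, thickening and coning off -/

section Constructions

variable {V : Type*}

/-- The clique complex of the graph `G` restricted to the vertex set `S`. -/
def cliqueComplexOn (S : Set V) (G : SimpleGraph V) : PreAbstractSimplicialComplex V where
  faces := {s | s.Nonempty ∧ (s : Set V) ⊆ S ∧ G.IsClique (s : Set V)}
  isRelLowerSet_faces := fun {_} hs => ⟨hs.1, fun _ hts ht =>
    ⟨ht, (Finset.coe_subset.2 hts).trans hs.2.1, hs.2.2.subset (Finset.coe_subset.2 hts)⟩⟩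

variable [LinearOrder V]

/-- Vertices of the thickening: `(0, v)` in the outer layer and `(1, v)` in the inner layer. -/
abbrev Layered (V : Type*) : Type _ := Fin 2 ×ₗ V

/-- The thickening of `K` with respect to an ordering `r` of its vertices: its simplices are
`[(u₁,0) … (u_a,0) (v₁,1) … (v_b,1)]` with `u₁ < … < u_a ≤ v₁ < … < v_b` and
`{u₁, …, u_a, v₁, …, v_b}` a simplex of `K`. -/
def thickening (K : PreAbstractSimplicialComplex V) (r : V → V → Prop) :
    PreAbstractSimplicialComplex (Layered V) where
  faces := {s | s.image (fun x => (ofLex x).2) ∈ K.faces ∧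
    ∀ x ∈ s, ∀ y ∈ s, (ofLex x).1 = 0 → (ofLex y).1 = 1 →
      (ofLex x).2 = (ofLex y).2 ∨ r (ofLex x).2 (ofLex y).2}
  isRelLowerSet_faces := fun {_} hs =>
    ⟨Finset.image_nonempty.1 (K.isRelLowerSet_faces hs.1).1, fun _ hts ht =>
      ⟨(K.isRelLowerSet_faces hs.1).2 (Finset.image_subset_image hts) (ht.image _),
        fun x hx y hy => hs.2 x (hts hx) y (hts hy)⟩⟩

/-- Coning off the inner layer: the central vertex `⊤` is joined to all simplices of `L` that lie
in the inner layer. -/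
def coneOff (L : PreAbstractSimplicialComplex (Layered V)) :
    PreAbstractSimplicialComplex (WithTop (Layered V)) where
  faces := {s | ∃ τ ∈ L.faces, s = τ.image (fun x : Layered V => (x : WithTop (Layered V)))} ∪
    {s | ∃ τ : Finset (Layered V), (τ = ∅ ∨ τ ∈ L.faces) ∧ (∀ x ∈ τ, (ofLex x).1 = 1) ∧
      s = insert ⊤ (τ.image (fun x : Layered V => (x : WithTop (Layered V))))}
  isRelLowerSet_faces := by
    have hsub (τ t : Finset (Layered V)) (h : τ = ∅ ∨ τ ∈ L.faces) (ht : t ⊆ τ) :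
        t = ∅ ∨ t ∈ L.faces := by
      rcases t.eq_empty_or_nonempty with h0 | h0
      · exact Or.inl h0
      · rcases h with rfl | h
        · exact Or.inl (Finset.subset_empty.1 ht)
        · exact Or.inr ((L.isRelLowerSet_faces h).2 ht h0)
    rintro s (⟨τ, hτ, rfl⟩ | ⟨τ, hτ, hin, rfl⟩)
    · refine ⟨(L.isRelLowerSet_faces hτ).1.image _, fun t hts ht => Or.inl ?_⟩
      obtain ⟨t', ht', rfl⟩ := Finset.subset_image_iff.1 hts
      exact ⟨t', (L.isRelLowerSet_faces hτ).2 (Finset.coe_subset.1 ht') (Finset.image_nonempty.1 ht),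
        rfl⟩
    · refine ⟨Finset.insert_nonempty _ _, fun t hts ht => ?_⟩
      obtain ⟨t', ht', he⟩ := Finset.subset_image_iff.1 (Finset.subset_insert_iff.1 hts)
      have ht' : t' ⊆ τ := Finset.coe_subset.1 ht'
      by_cases htop : ⊤ ∈ t
      · refine Or.inr ⟨t', hsub _ _ hτ ht', fun x hx => hin x (ht' hx), ?_⟩
        rw [he, Finset.insert_erase htop]
      · rw [Finset.erase_eq_of_notMem htop] at he
        subst he
        rcases hsub _ _ hτ ht' with rfl | h
        · simp at ht
        · exact Or.inl ⟨t', h, rfl⟩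

/-- The inclusion of `V` as the outer layer. -/
def outer (V : Type*) [LinearOrder V] : V ↪o WithTop (Layered V) :=
  OrderEmbedding.ofMapLEIff (fun v => ((toLex (0, v) : Layered V) : WithTop (Layered V)))
    (fun a b => by simp [Prod.Lex.toLex_le_toLex])

/-- The gadget which fills in the subcomplex `J`: the coned-off thickening of `J`. -/
def gadget (J : PreAbstractSimplicialComplex V) (r : V → V → Prop) :
    PreAbstractSimplicialComplex (WithTop (Layered V)) :=
  coneOff (thickening J r)

/-- The result of gluing the gadget for `J` onto the complex `Q` containing `J`, by identifying the
outer layer of the gadget with `J`. -/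
def gluedComplex (Q J : PreAbstractSimplicialComplex V) (r : V → V → Prop) :
    PreAbstractSimplicialComplex (WithTop (Layered V)) :=
  Q.map (outer V) ⊔ gadget J r

theorem outer_mem_gluedComplex (Q J : PreAbstractSimplicialComplex V) (r : V → V → Prop) :
    ∀ s ∈ Q.faces, s.map (outer V).toEmbedding ∈ (gluedComplex Q J r).faces :=
  fun s hs => Or.inl ⟨s, hs, by rw [Finset.map_eq_image]; rfl⟩

/-- The vertices of the outer layer have weight `1`; the inner layer and the central vertex have
weight `lam`. -/
def gadgetWeight (V : Type*) [LinearOrder V] (lam : ℝ) (x : WithTop (Layered V)) : ℝ :=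
  open Classical in if x ∈ Set.range (outer V) then 1 else lam

end Constructions

/-! ### The qubit graph and its computational basis cycles -/

/-- The vertices `x, a₂, a₃, a₄, b₂, b₃, b₄` of the bowtie are numbered `0, …, 6`. The loop of the
bit `false` (that is, `0`) visits `x, a₃, a₂, a₄`, and that of `true` visits `x, b₃, b₂, b₄`. -/
def loopVertex : Bool → Fin 4 → Fin 7
  | false => ![0, 2, 1, 3]
  | true => ![0, 5, 4, 6]

/-- The bowtie graph: two square loops sharing the vertex `x`. -/
def bowtie : SimpleGraph (Fin 7) :=
  SimpleGraph.fromRel fun u v => ∃ b i, u = loopVertex b i ∧ v = loopVertex b (i + 1)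

/-- Vertices of the `m`-qubit graph: `(i, v)` is the vertex `v` of the `i`-th copy of the bowtie. -/
abbrev QubitVertex (m : ℕ) : Type := Fin m ×ₗ Fin 7

instance (m : ℕ) : Finite (QubitVertex m) := inferInstanceAs (Finite (Fin m × Fin 7))

instance (V : Type*) [Finite V] : Finite (Layered V) := inferInstanceAs (Finite (Fin 2 × V))

instance (V : Type*) [Finite V] : Finite (WithTop V) := inferInstanceAs (Finite (Option V))

/-- The `m`-fold join of the bowtie graph. -/
def qubitGraph (m : ℕ) : SimpleGraph (QubitVertex m) where
  Adj x y := (ofLex x).1 ≠ (ofLex y).1 ∨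
    ((ofLex x).1 = (ofLex y).1 ∧ bowtie.Adj (ofLex x).2 (ofLex y).2)
  symm := ⟨fun _ _ h => h.imp Ne.symm fun h => ⟨h.1.symm, h.2.symm⟩⟩
  loopless := ⟨fun _ h => h.elim (fun h => h rfl) fun h => bowtie.loopless.irrefl _ h.2⟩

def qubitComplex (m : ℕ) : PreAbstractSimplicialComplex (QubitVertex m) :=
  cliqueComplexOn Set.univ (qubitGraph m)

/-- The subcomplex of the computational basis state `|z⟩`: the join of the loops of the bits
`z i`. -/
def basisComplex {m : ℕ} (z : Fin m → Bool) : PreAbstractSimplicialComplex (QubitVertex m) :=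
  cliqueComplexOn {x | (ofLex x).2 ∈ Set.range (loopVertex (z (ofLex x).1))} (qubitGraph m)

/-- The coefficient of the increasingly oriented edge `e` in the loop of the bit `b`, that is, in
`[x a₃] + [a₃ a₂] + [a₂ a₄] + [a₄ x]` for `b = false`, and likewise for `true`. -/
def loopCoeff (b : Bool) (e : Finset (Fin 7)) : ℂ :=
  ∑ i : Fin 4, if e = {loopVertex b i, loopVertex b (i + 1)} then
    (if loopVertex b i < loopVertex b (i + 1) then 1 else -1) else 0

/-- The part of a simplex that lies in the `i`-th copy of the bowtie. -/
def block {m : ℕ} (s : Finset (QubitVertex m)) (i : Fin m) : Finset (Fin 7) :=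
  {v | toLex (i, v) ∈ s}

/-- The cycle of the computational basis state `|z⟩ = |z₁⟩ ⊗ … ⊗ |z_m⟩`, the join of the loops of
the bits `z i`; it has dimension `2 m - 1`. -/
def basisCycle {m : ℕ} (z : Fin m → Bool) : Chain (qubitComplex m) (2 * m) :=
  fun s => ∏ i, loopCoeff (z i) (block s.1 i)

/-- The clique complex of the `m`-qubit graph with the gadget for `|z⟩` glued in. -/
abbrev gadgetComplex {m : ℕ} (z : Fin m → Bool) (r : QubitVertex m → QubitVertex m → Prop) :
    PreAbstractSimplicialComplex (WithTop (Layered (QubitVertex m))) :=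
  gluedComplex (qubitComplex m) (basisComplex z) r

/-- The map on homology induced by including the qubit complex. -/
abbrev gadgetMap {m : ℕ} (z : Fin m → Bool) (r : QubitVertex m → QubitVertex m → Prop) (p : ℕ) :
    Homology (qubitComplex m) p →ₗ[ℂ] Homology (gadgetComplex z r) p :=
  homologyMap _ _ (outer (QubitVertex m)) (outer_mem_gluedComplex _ _ r) p

end CliqueGadget

end

open CliqueGadget

noncomputable section

namespace CliqueGadget

open Finset

/-! ### Creation and annihilation operators on chains of the full simplex -/

section Fock

variable {V : Type*} [LinearOrder V]

/-! The glued complex is a clique complex (`gluedComplex_eq_cliqueComplexOn`), so its topology can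
be studied by deleting vertices. Let $Q$ be the qubit complex. Without the apex `⊤` it is $Q$ with
the thickening of $\mathcal J$ attached. There every inner vertex is dominated by its outer copy,
provided inner vertices are deleted in increasing order, so deleting the inner layer keeps the
homology. Likewise the thickening is homology equivalent to each of its two layers
(`homologyEquiv_diff_inner`, `homologyEquiv_inner`).

The apex then cones off a copy of $\mathcal J$, whose homology is the line spanned by $|z\rangle$.
This is a Mayer–Vietoris argument on chains (`ConeAttachment`). If $b$ fills a cycle of $Q$, the
part of $b$ on the link of the apex is a cycle of the inner layer, hence homologous to a multiple of
$|z\rangle$; removing the cone over it shows that the kernel is the line of $|z\rangle$. If $c$ is a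
cycle of the glued complex, the same multiple of $|z\rangle$ bounds in $Q$, so it vanishes, the link
part bounds, and $c$ can be pushed off the apex: no new class arises.

The homology of $Q$ and that of $\mathcal J$ are found together, by induction on the copies of the
bowtie with a set `B i` of allowed bits in each copy. A cycle is cleared of the vertex opposite $x$
on each loop, at the cost of joins of loops and boundaries; what remains lies in a cone with apex
$x$ (`mem_loopsAndBoundaries`). The joins are independent because the bowtie has no triangle: they
live in the top dimension, and each has a facet of its own.

The Witten index is minus the reduced Euler characteristic for all weights, by rank–nullity and
telescoping; the same telescoping gives the Euler–Poincaré formula.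

Chains are functions `Finset V → ℂ` of mixed degree, acted on by fermionic operators `ann` and
`cre`. Only the last part returns to fixed degrees, through `extend` and `restrict`. -/

/-- The sign picked up when moving `v` into its place in the increasing list of `s`. -/
def vertexSign (s : Finset V) (v : V) : ℂ := (-1) ^ #{u ∈ s | u < v}

theorem vertexSign_mul_self (s : Finset V) (v : V) : vertexSign s v * vertexSign s v = 1 := by
  rw [vertexSign, ← mul_pow]; simp

theorem vertexSign_insert {s : Finset V} {v : V} (hv : v ∉ s) (w : V) :
    vertexSign (insert v s) w = (if v < w then -1 else 1) * vertexSign s w := by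
  unfold vertexSign
  rw [Finset.filter_insert]
  split_ifs with h
  · rw [Finset.card_insert_of_notMem (by simp [hv]), pow_succ]; ring
  · rw [one_mul]

theorem vertexSign_erase_self (s : Finset V) (v : V) :
    vertexSign (s.erase v) v = vertexSign s v := by
  unfold vertexSign
  congr 2
  ext u
  simp only [mem_filter, mem_erase]
  constructor
  · rintro ⟨⟨_, h⟩, h'⟩; exact ⟨h, h'⟩
  · rintro ⟨h, h'⟩; exact ⟨⟨h'.ne, h⟩, h'⟩

theorem vertexSign_insert_self (s : Finset V) (v : V) :
    vertexSign (insert v s) v = vertexSign s v := by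
  rw [← vertexSign_erase_self (insert v s), ← vertexSign_erase_self s, Finset.erase_insert_eq_erase]

/-- Removing the vertex `v`. -/
def ann (v : V) : (Finset V → ℂ) →ₗ[ℂ] (Finset V → ℂ) where
  toFun c s := if v ∈ s then 0 else vertexSign s v * c (insert v s)
  map_add' c c' := by ext s; simp only [Pi.add_apply]; split_ifs <;> ring
  map_smul' a c := by ext s; simp only [Pi.smul_apply, smul_eq_mul, RingHom.id_apply]; split_ifs <;> ring

/-- Adding the vertex `v`. -/
def cre (v : V) : (Finset V → ℂ) →ₗ[ℂ] (Finset V → ℂ) where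
  toFun c s := if v ∈ s then vertexSign s v * c (s.erase v) else 0
  map_add' c c' := by ext s; simp only [Pi.add_apply]; split_ifs <;> ring
  map_smul' a c := by ext s; simp only [Pi.smul_apply, smul_eq_mul, RingHom.id_apply]; split_ifs <;> ring

theorem ann_apply (v : V) (c : Finset V → ℂ) (s : Finset V) :
    ann v c s = if v ∈ s then 0 else vertexSign s v * c (insert v s) := rfl

theorem cre_apply (v : V) (c : Finset V → ℂ) (s : Finset V) :
    cre v c s = if v ∈ s then vertexSign s v * c (s.erase v) else 0 := rfl

/-- The order of two distinct vertices is seen by exactly one of the two operators applied; this is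
the source of all anticommutation below. -/
theorem sign_lt_swap {v w : V} (h : v ≠ w) :
    (if v < w then (-1 : ℂ) else 1) = -(if w < v then (-1 : ℂ) else 1) := by
  rcases lt_or_gt_of_ne h with h | h
  · simp [h, h.not_gt]
  · simp [h, h.not_gt]

theorem ann_ann_self (v : V) (c : Finset V → ℂ) : ann v (ann v c) = 0 := by
  ext s
  simp [ann_apply]

theorem ann_ann (v w : V) (c : Finset V → ℂ) : ann v (ann w c) = -ann w (ann v c) := by
  rcases eq_or_ne v w with rfl | h
  · simp [ann_ann_self]
  ext s
  simp only [ann_apply, Pi.neg_apply, mem_insert, h, h.symm, false_or]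
  by_cases hv : v ∈ s
  · simp [hv]
  by_cases hw : w ∈ s
  · simp [hw]
  simp only [hv, hw, if_false]
  rw [vertexSign_insert hv, vertexSign_insert hw, Finset.insert_comm v w, sign_lt_swap h]
  ring

theorem cre_cre_self (v : V) (c : Finset V → ℂ) : cre v (cre v c) = 0 := by
  ext s
  simp [cre_apply]

theorem cre_cre (v w : V) (c : Finset V → ℂ) : cre v (cre w c) = -cre w (cre v c) := by
  rcases eq_or_ne v w with rfl | h
  · simp [cre_cre_self]
  ext s
  simp only [cre_apply, Pi.neg_apply, mem_erase, ne_eq, h, h.symm, not_false_eq_true, true_and]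
  by_cases hv : v ∈ s
  · by_cases hw : w ∈ s
    · simp only [hv, hw, if_true]
      have hv' : v ∉ s.erase v := by simp
      have hw' : w ∉ s.erase w := by simp
      have e1 := vertexSign_insert hv' w
      have e2 := vertexSign_insert hw' v
      rw [Finset.insert_erase hv] at e1
      rw [Finset.insert_erase hw] at e2
      rw [e1, e2, Finset.erase_right_comm, sign_lt_swap h]
      ring
    · simp [hw]
  · simp [hv]

theorem ann_cre {v w : V} (h : v ≠ w) (c : Finset V → ℂ) :
    ann v (cre w c) = -cre w (ann v c) := by
  ext s
  simp only [cre_apply, ann_apply, Pi.neg_apply, mem_erase, mem_insert, ne_eq, h, h.symm,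
    not_false_eq_true, true_and, false_or]
  by_cases hv : v ∈ s
  · simp [hv]
  by_cases hw : w ∈ s
  · simp only [hv, hw, if_false, if_true]
    have hw' : w ∉ s.erase w := by simp
    have e2 := vertexSign_insert hw' v
    rw [Finset.insert_erase hw] at e2
    rw [e2, vertexSign_insert hv, Finset.erase_insert_of_ne h, sign_lt_swap h]
    split_ifs <;> ring
  · simp [hw]

/-- The last of the canonical anticommutation relations. The identities for `bdW` below follow from
them formally. -/
theorem ann_cre_self (v : V) (c : Finset V → ℂ) : ann v (cre v c) = c - cre v (ann v c) := by
  ext s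
  simp only [cre_apply, ann_apply, Pi.sub_apply, mem_erase, mem_insert, ne_eq, true_or,
    not_true_eq_false, false_and, if_false, if_true]
  by_cases hv : v ∈ s
  · simp only [hv, if_true, Finset.insert_erase hv, vertexSign_erase_self]
    rw [← mul_assoc, vertexSign_mul_self]; ring
  · simp only [hv, if_false, Finset.erase_insert hv, vertexSign_insert_self]
    rw [← mul_assoc, vertexSign_mul_self]; ring

variable [Fintype V]

/-- The boundary operator with vertex weights `w` on the chains of the full simplex. -/
def bdW (w : V → ℂ) : (Finset V → ℂ) →ₗ[ℂ] (Finset V → ℂ) := ∑ v, w v • ann v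

theorem bdW_apply (w : V → ℂ) (c : Finset V → ℂ) : bdW w c = ∑ v, w v • ann v c := by
  simp [bdW]

theorem bdW_ann (w : V → ℂ) (v : V) (c : Finset V → ℂ) : bdW w (ann v c) = -ann v (bdW w c) := by
  simp only [bdW_apply, map_sum, map_smul, ← Finset.sum_neg_distrib]
  refine Finset.sum_congr rfl fun u _ => ?_
  rw [ann_ann, smul_neg]

/-- Expanding the inner boundary and moving the outer one past each `ann` changes the sign, so the
double boundary is its own negative. -/
theorem bdW_bdW (w : V → ℂ) (c : Finset V → ℂ) : bdW w (bdW w c) = 0 := by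
  have h : bdW w (bdW w c) = -bdW w (bdW w c) := by
    conv_lhs => rw [bdW_apply w c, map_sum]
    conv_rhs => rw [bdW_apply w (bdW w c)]
    rw [← Finset.sum_neg_distrib]
    refine Finset.sum_congr rfl fun u _ => ?_
    rw [map_smul, bdW_ann, smul_neg]
  exact self_eq_neg.1 h

/-- The cone formula: all terms `u ≠ v` of the boundary anticommute with `cre v`, and `u = v`
contributes the base of the cone. -/
theorem bdW_cre (w : V → ℂ) (v : V) (c : Finset V → ℂ) :
    bdW w (cre v c) = w v • c - cre v (bdW w c) := by
  simp only [bdW_apply, map_sum, map_smul]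
  rw [← Finset.add_sum_erase Finset.univ (fun u => w u • ann u (cre v c)) (Finset.mem_univ v),
    ← Finset.add_sum_erase Finset.univ (fun u => w u • cre v (ann u c)) (Finset.mem_univ v),
    ann_cre_self, smul_sub, sub_add_eq_sub_sub, sub_eq_add_neg (_ - _) (∑ u ∈ _, _),
    ← Finset.sum_neg_distrib]
  congr 1
  refine Finset.sum_congr rfl fun u hu => ?_
  rw [ann_cre (Finset.ne_of_mem_erase hu), smul_neg]

/-- The unweighted boundary operator on the chains of the full simplex. -/
abbrev bd : (Finset V → ℂ) →ₗ[ℂ] (Finset V → ℂ) := bdW fun _ => 1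

theorem bd_cre (v : V) (c : Finset V → ℂ) : bd (cre v c) = c - cre v (bd c) := by
  rw [bdW_cre, one_smul]

/-- Suspension with poles `v` and `w`: the bases of the two cones cancel. -/
theorem bd_cre_sub_cre (v w : V) (c : Finset V → ℂ) :
    bd (cre v c - cre w c) = -(cre v (bd c) - cre w (bd c)) := by
  rw [map_sub, bd_cre, bd_cre]; abel

/-- A cycle in a cone is the boundary of the cone over it. -/
theorem bd_cre_of_bd_eq_zero (v : V) {c : Finset V → ℂ} (hc : bd c = 0) : bd (cre v c) = c := by
  rw [bd_cre, hc, map_zero, sub_zero]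

end Fock

/-! ### Chains of clique complexes and dismantling -/

section CliqueChains

variable {V : Type*} (G : SimpleGraph V)

/-- The chains supported on the cliques of `G` with all vertices in `S`. -/
def cliqueChains (S : Set V) : Submodule ℂ (Finset V → ℂ) where
  carrier := {c | ∀ s : Finset V, c s ≠ 0 → (s : Set V) ⊆ S ∧ G.IsClique (s : Set V)}
  zero_mem' := fun s hs => absurd rfl hs
  add_mem' := fun {a b} ha hb s hs => by
    by_cases h : a s = 0
    · exact hb s fun h' => hs (by simp [h, h'])
    · exact ha s h
  smul_mem' := fun a c hc s hs => hc s fun h => hs (by simp [h])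

variable {G}

theorem cliqueChains_mono {S T : Set V} (h : S ⊆ T) : cliqueChains G S ≤ cliqueChains G T :=
  fun _ hc s hs => ⟨(hc s hs).1.trans h, (hc s hs).2⟩

variable [LinearOrder V]

/-- `ann v` extracts the part of a chain on the link of `v`. -/
theorem ann_mem_cliqueChains {S : Set V} {c : Finset V → ℂ} (hc : c ∈ cliqueChains G S) (v : V) :
    ann v c ∈ cliqueChains G {u ∈ S | G.Adj v u} := by
  intro s hs
  rw [ann_apply] at hs
  split_ifs at hs with hv
  · exact absurd rfl hs
  obtain ⟨h1, h2⟩ := hc _ (right_ne_zero_of_mul hs)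
  rw [Finset.coe_insert, Set.insert_subset_iff] at h1
  rw [Finset.coe_insert, SimpleGraph.isClique_insert_of_notMem (by simpa using hv)] at h2
  exact ⟨fun u hu => ⟨h1.2 hu, h2.2 u hu⟩, h2.1⟩

/-- The apex `v` may belong to `S`, since `cre v` discards the simplices that already contain it. -/
theorem cre_mem_cliqueChains {S T : Set V} {c : Finset V → ℂ} (hc : c ∈ cliqueChains G S) {v : V}
    (hv : v ∈ T) (hST : S ⊆ T) (h : ∀ u ∈ S, u ≠ v → G.Adj v u) :
    cre v c ∈ cliqueChains G T := by
  intro s hs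
  rw [cre_apply] at hs
  split_ifs at hs with hvs
  · obtain ⟨h1, h2⟩ := hc _ (right_ne_zero_of_mul hs)
    rw [← Finset.insert_erase hvs, Finset.coe_insert]
    refine ⟨Set.insert_subset hv (h1.trans hST), ?_⟩
    rw [SimpleGraph.isClique_insert_of_notMem (by simp)]
    exact ⟨h2, fun u hu => h u (h1 hu) (Finset.ne_of_mem_erase hu)⟩
  · exact absurd rfl hs

/-- `cre v (ann v c)` is exactly the part of `c` on the simplices that contain `v`. -/
theorem sub_cre_ann_mem_cliqueChains {S : Set V} {c : Finset V → ℂ}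
    (hc : c ∈ cliqueChains G S) (v : V) : c - cre v (ann v c) ∈ cliqueChains G (S \ {v}) := by
  intro s hs
  rw [Pi.sub_apply, cre_apply] at hs
  by_cases hv : v ∈ s
  · rw [if_pos hv, ann_apply, if_neg (by simp), Finset.insert_erase hv, vertexSign_erase_self,
      ← mul_assoc, vertexSign_mul_self, one_mul, sub_self] at hs
    exact absurd rfl hs
  · rw [if_neg hv, sub_zero] at hs
    refine ⟨fun u hu => ⟨(hc s hs).1 hu, ?_⟩, (hc s hs).2⟩
    rintro rfl
    exact hv hu

theorem ann_eq_zero {S : Set V} {c : Finset V → ℂ} (hc : c ∈ cliqueChains G S) {v : V}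
    (hv : v ∉ S) : ann v c = 0 := by
  ext s
  rw [ann_apply]
  split_ifs with h
  · rfl
  · by_contra h'
    exact hv ((hc _ (right_ne_zero_of_mul h')).1 (by simp))

variable [Fintype V]

theorem bd_ann_eq_zero {c : Finset V → ℂ} (hc : bd c = 0) (v : V) : bd (ann v c) = 0 := by
  rw [bdW_ann, hc, map_zero, neg_zero]

/-! ### Homology equivalences and dismantling -/

variable (G) in
/-- The inclusion of the cliques in `A` into those in `B` induces an isomorphism on homology. -/
structure HomologyEquiv (A B : Set V) : Prop where
  surj : ∀ c ∈ cliqueChains G B, bd c = 0 →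
    ∃ a ∈ cliqueChains G A, bd a = 0 ∧ ∃ b ∈ cliqueChains G B, c = a + bd b
  inj : ∀ a ∈ cliqueChains G A, ∀ b ∈ cliqueChains G B, a = bd b →
    ∃ b' ∈ cliqueChains G A, a = bd b'

theorem HomologyEquiv.refl (A : Set V) : HomologyEquiv G A A :=
  ⟨fun c hc h => ⟨c, hc, h, 0, Submodule.zero_mem _, by simp⟩, fun _ _ b hb h => ⟨b, hb, h⟩⟩

theorem HomologyEquiv.trans {A B C : Set V} (hBC : B ⊆ C)
    (h1 : HomologyEquiv G A B) (h2 : HomologyEquiv G B C) (hAB : A ⊆ B) : HomologyEquiv G A C := by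
  refine ⟨fun c hc h => ?_, fun a ha b hb h => ?_⟩
  · obtain ⟨a, ha, ha', b, hb, rfl⟩ := h2.surj c hc h
    obtain ⟨d, hd, hd', e, he, rfl⟩ := h1.surj a ha ha'
    exact ⟨d, hd, hd', e + b, Submodule.add_mem _ (cliqueChains_mono hBC he) hb, by
      rw [map_add]; abel⟩
  · obtain ⟨b', hb', h'⟩ := h2.inj a (cliqueChains_mono hAB ha) b hb h
    exact h1.inj a ha b' hb' h'

/-- Removing a vertex `v` that is dominated by another vertex `w`. -/
theorem homologyEquiv_of_dominated {S : Set V} {v w : V} (hw : w ∈ S) (hwv : G.Adj v w)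
    (h : ∀ u ∈ S, G.Adj v u → u ≠ w → G.Adj w u) : HomologyEquiv G (S \ {v}) S := by
  have hne : w ≠ v := hwv.ne'
  -- replacing the vertex `v` by `w` is a chain map
  let φ (c : Finset V → ℂ) : Finset V → ℂ := c - cre v (ann v c) + cre w (ann v c)
  have hφ (c) (hc : c ∈ cliqueChains G S) : φ c ∈ cliqueChains G (S \ {v}) := by
    refine Submodule.add_mem _ (sub_cre_ann_mem_cliqueChains hc v)
      (cre_mem_cliqueChains (ann_mem_cliqueChains hc v) ⟨hw, hne⟩ ?_ ?_)
    · exact fun u hu => ⟨hu.1, fun h' => (hu.2.ne h'.symm).elim⟩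
    · exact fun u hu hu' => h u hu.1 hu.2 hu'
  have hbd (c) : bd (φ c) = φ (bd c) := by
    simp only [φ, map_add, map_sub, bd_cre, bdW_ann, map_neg]
    abel
  -- The join of the link part with the edge `w v` is the homotopy from `φ` to the identity.
  refine ⟨fun c hc hc0 => ⟨φ c, hφ c hc, ?_, cre w (cre v (ann v c)), ?_, ?_⟩,
    fun a ha b hb hab => ⟨φ b, hφ b hb, ?_⟩⟩
  · rw [hbd, hc0]; simp [φ]
  · have h1 : cre v (ann v c) ∈ cliqueChains G ({u ∈ S | u = v ∨ G.Adj v u}) := by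
      by_cases hv : v ∈ S
      · exact cre_mem_cliqueChains (ann_mem_cliqueChains hc v) ⟨hv, Or.inl rfl⟩
          (fun u hu => ⟨hu.1, Or.inr hu.2⟩) fun u hu _ => hu.2
      · rw [ann_eq_zero hc hv, map_zero]; exact Submodule.zero_mem _
    refine cre_mem_cliqueChains h1 hw (fun u hu => hu.1) ?_
    rintro u ⟨huS, rfl | hu⟩ hu'
    · exact hwv.symm
    · exact h u huS hu hu'
  · simp only [φ, bd_cre, bdW_ann, hc0, map_zero, neg_zero, sub_zero]
    abel
  -- `φ` fixes the chains that avoid `v`, so it carries a filling of `a` to a filling of `a`.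
  · rw [hbd, ← hab]
    simp [φ, ann_eq_zero ha (v := v) (by simp)]

/-- Removing the vertices of `R` in increasing order, if each of them is dominated at its turn by a
vertex that stays. -/
theorem homologyEquiv_of_dismantling (r : V → V → Prop) [IsStrictOrder V r] {S : Set V} (f : V → V)
    (R : Finset V) (hf : ∀ v ∈ R, f v ∈ S ∧ f v ∉ R ∧ G.Adj v (f v))
    (h : ∀ v ∈ R, ∀ u ∈ S, G.Adj v u → (u ∈ R → ¬ r u v) → u ≠ f v → G.Adj (f v) u) :
    HomologyEquiv G (S \ R) S := by
  classical
  induction hn : #R generalizing R with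
  | zero =>
    rw [Finset.card_eq_zero] at hn
    subst hn
    simpa using HomologyEquiv.refl S
  | succ n ih =>
    have hne : R.Nonempty := Finset.card_pos.1 (by omega)
    -- Here `v` is an `r`-maximal element of `R`, the last to go. The induction hypothesis deletes
    -- the others first, and at its turn `v` has no neighbour left in `R`.
    have : WellFounded (Function.swap r) := Finite.wellFounded_of_trans_of_irrefl _
    obtain ⟨v, hv, hmax⟩ := this.has_min (R : Set V) hne
    have h1 : HomologyEquiv G (S \ ↑(R.erase v)) S := by
      refine ih (R.erase v) (fun u hu => ?_) (fun u hu x hx hux hxR => ?_) ?_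
      · obtain ⟨h1, h2, h3⟩ := hf u (Finset.mem_of_mem_erase hu)
        exact ⟨h1, fun h' => h2 (Finset.mem_of_mem_erase h'), h3⟩
      · refine h u (Finset.mem_of_mem_erase hu) x hx hux fun hxR' => ?_
        by_cases hxv : x = v
        · subst hxv
          exact hmax u (Finset.mem_of_mem_erase hu)
        · exact hxR (Finset.mem_erase.2 ⟨hxv, hxR'⟩)
      · rw [Finset.card_erase_of_mem hv, hn]; rfl
    have h2 : HomologyEquiv G ((S \ ↑(R.erase v)) \ {v}) (S \ ↑(R.erase v)) := by
      obtain ⟨h1, h2, h3⟩ := hf v hv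
      refine homologyEquiv_of_dominated (w := f v)
        ⟨h1, fun h' => h2 (Finset.mem_of_mem_erase h')⟩ h3 fun u hu huv => ?_
      refine h v hv u hu.1 huv fun huR => (hu.2 ?_).elim
      exact Finset.mem_coe.2 (Finset.mem_erase.2 ⟨huv.ne', huR⟩)
    have h3 : (S \ ↑(R.erase v)) \ {v} = S \ (R : Set V) := by
      ext u
      simp only [Finset.coe_erase, Set.mem_sdiff, Set.mem_singleton_iff, Finset.mem_coe]
      constructor
      · rintro ⟨⟨h1, h2⟩, h3⟩; exact ⟨h1, fun h => h2 ⟨h, h3⟩⟩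
      · rintro ⟨h1, h2⟩; exact ⟨⟨h1, fun h => h2 h.1⟩, fun h => h2 (h ▸ hv)⟩
    rw [h3] at h2
    exact HomologyEquiv.trans Set.sdiff_subset h2 h1 (Set.sdiff_subset_sdiff_right (by simp))

/-- Attaching a cone with apex `t` over the inner layer `T₁` of a complex `T`, which is homology
equivalent to both of its layers `T₀` and `T₁`, when the homology of `T₀` is spanned by the class
of `z`. -/
structure ConeAttachment (G : SimpleGraph V) (S₀ S T₀ T₁ T : Set V) (t : V)
    (z : Finset V → ℂ) : Prop where
  apex_mem : t ∈ S
  outer_subset : S₀ ⊆ S \ {t}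
  subset : T ⊆ S \ {t}
  subset_outer : T₀ ⊆ S₀
  subset_zero : T₀ ⊆ T
  subset_one : T₁ ⊆ T
  link : ∀ u ∈ S, G.Adj t u ↔ u ∈ T₁
  equiv : HomologyEquiv G S₀ (S \ {t})
  equiv_zero : HomologyEquiv G T₀ T
  equiv_one : HomologyEquiv G T₁ T
  cycle_mem : z ∈ cliqueChains G T₀
  bd_cycle : bd z = 0
  spanned : ∀ c ∈ cliqueChains G T₀, bd c = 0 → ∃ a : ℂ, ∃ b ∈ cliqueChains G T₀, c = a • z + bd b
  indep : ∀ a : ℂ, ∀ b ∈ cliqueChains G S₀, a • z = bd b → a = 0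

namespace ConeAttachment

variable {S₀ S T₀ T₁ T : Set V} {t : V} {z : Finset V → ℂ} (h : ConeAttachment G S₀ S T₀ T₁ T t z)
include h

theorem cre_apex_mem {c : Finset V → ℂ} (hc : c ∈ cliqueChains G T₁) :
    cre t c ∈ cliqueChains G S :=
  cre_mem_cliqueChains hc h.apex_mem
    (fun _ hu => (h.subset (h.subset_one hu)).1)
    fun u hu _ => (h.link u (h.subset (h.subset_one hu)).1).2 hu

theorem ann_apex_mem {c : Finset V → ℂ} (hc : c ∈ cliqueChains G S) :
    ann t c ∈ cliqueChains G T₁ :=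
  cliqueChains_mono (fun u hu => (h.link u hu.1).1 hu.2) (ann_mem_cliqueChains hc t)

/-- Within `T` the cycle `z` slides to a cycle of the inner layer, which the apex cones off. -/
theorem exists_bd_eq : ∃ b ∈ cliqueChains G S, z = bd b := by
  obtain ⟨a, ha, ha0, b, hb, hz⟩ :=
    h.equiv_one.surj z (cliqueChains_mono h.subset_zero h.cycle_mem) h.bd_cycle
  refine ⟨cre t a + b, Submodule.add_mem _ (h.cre_apex_mem ha)
    (cliqueChains_mono (h.subset.trans Set.sdiff_subset) hb), ?_⟩
  rw [map_add, bd_cre_of_bd_eq_zero t ha0, hz]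

/-- The link part `ann t b` is a cycle because `c` avoids `t`. In `T` it is homologous to some `μ •
z`; trading the cone over it for that homology gives a filling of `c - μ • z` that avoids `t`, which
`equiv` moves into `S₀`. -/
theorem exists_of_eq_bd {c b : Finset V → ℂ} (hc : c ∈ cliqueChains G S₀)
    (hb : b ∈ cliqueChains G S) (hcb : c = bd b) :
    ∃ a : ℂ, ∃ b' ∈ cliqueChains G S₀, c = a • z + bd b' := by
  have hf := h.ann_apex_mem hb
  have hf0 : bd (ann t b) = 0 := by
    rw [bdW_ann, ← hcb, ann_eq_zero hc fun ht => (h.outer_subset ht).2 rfl, neg_zero]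
  obtain ⟨a, ha, ha0, g, hg, hfa⟩ :=
    h.equiv_zero.surj _ (cliqueChains_mono h.subset_one hf) hf0
  obtain ⟨μ, g', hg', rfl⟩ := h.spanned a ha ha0
  have hb0 := sub_cre_ann_mem_cliqueChains hb t
  have hcyc : c - μ • z = bd (b - cre t (ann t b) + g + g') := by
    rw [map_add, map_add, map_sub, bd_cre_of_bd_eq_zero t hf0, ← hcb, hfa]
    abel
  obtain ⟨b', hb', h'⟩ := h.equiv.inj (c - μ • z)
    (Submodule.sub_mem _ hc (Submodule.smul_mem _ _ (cliqueChains_mono h.subset_outer h.cycle_mem)))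
    _ (Submodule.add_mem _ (Submodule.add_mem _ hb0 (cliqueChains_mono h.subset hg))
      (cliqueChains_mono (h.subset_zero.trans h.subset) hg')) hcyc
  exact ⟨μ, b', hb', by rw [← h']; abel⟩

theorem exists_eq_add_bd {c : Finset V → ℂ} (hc : c ∈ cliqueChains G S) (hc0 : bd c = 0) :
    ∃ a ∈ cliqueChains G S₀, bd a = 0 ∧ ∃ b ∈ cliqueChains G S, c = a + bd b := by
  have hf := h.ann_apex_mem hc
  have hf0 : bd (ann t c) = 0 := bd_ann_eq_zero hc0 t
  obtain ⟨a, ha, ha0, g, hg, hfa⟩ :=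
    h.equiv_zero.surj _ (cliqueChains_mono h.subset_one hf) hf0
  obtain ⟨μ, g', hg', rfl⟩ := h.spanned a ha ha0
  have hc' := sub_cre_ann_mem_cliqueChains hc t
  have hcyc : μ • z = bd (-(c - cre t (ann t c) + g + g')) := by
    rw [map_neg, map_add, map_add, map_sub, bd_cre_of_bd_eq_zero t hf0, hc0, hfa]
    abel
  obtain ⟨b', hb', h'⟩ := h.equiv.inj (μ • z)
    (Submodule.smul_mem _ _ (cliqueChains_mono h.subset_outer h.cycle_mem))
    _ (Submodule.neg_mem _ (Submodule.add_mem _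
      (Submodule.add_mem _ hc' (cliqueChains_mono h.subset hg))
      (cliqueChains_mono (h.subset_zero.trans h.subset) hg'))) hcyc
  -- A non-zero coefficient would give a new class. It is excluded because the class of `z` survives
  -- in `S₀`.
  obtain rfl := h.indep μ b' hb' h'
  obtain ⟨k, hk, hfk⟩ := h.equiv_one.inj _ hf (g' + g)
    (Submodule.add_mem _ (cliqueChains_mono h.subset_zero hg') hg) (by rw [hfa, map_add]; simp)
  -- The filling `k` of the link part lies in the inner layer, so adding the boundary of the cone
  -- over it replaces the cone `cre t (ann t c)` by `k` and frees the cycle from `t`.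
  have hck : c + bd (cre t k) = c - cre t (ann t c) + k := by
    rw [bd_cre, ← hfk]; abel
  obtain ⟨a, ha, ha0, b, hb, hab⟩ := h.equiv.surj (c + bd (cre t k))
    (hck ▸ Submodule.add_mem _ hc'
      (cliqueChains_mono (h.subset_one.trans h.subset) hk))
    (by rw [map_add, hc0, bdW_bdW, add_zero])
  refine ⟨a, ha, ha0, b - cre t k, Submodule.sub_mem _ (cliqueChains_mono Set.sdiff_subset hb)
    (h.cre_apex_mem hk), ?_⟩
  rw [map_sub, ← add_sub_assoc, ← hab, add_sub_cancel_right]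

end ConeAttachment

end CliqueChains

/-! ### The bowtie graph -/

section Bowtie

instance : DecidableRel bowtie.Adj := fun u v =>
  inferInstanceAs (Decidable (u ≠ v ∧ ((∃ b i, u = loopVertex b i ∧ v = loopVertex b (i + 1)) ∨
    ∃ b i, v = loopVertex b i ∧ u = loopVertex b (i + 1))))

/-- Each square loop is the join of the point pairs `{0, 2}` and `{1, 3}` of its positions, with
position `0` at `x` and position `2` opposite to it. -/
theorem bowtie_adj_loopVertex (b : Bool) :
    bowtie.Adj (loopVertex b 2) (loopVertex b 1) ∧ bowtie.Adj (loopVertex b 2) (loopVertex b 3) ∧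
    bowtie.Adj (loopVertex b 0) (loopVertex b 1) ∧ bowtie.Adj (loopVertex b 0) (loopVertex b 3) ∧
    ¬ bowtie.Adj (loopVertex b 3) (loopVertex b 1) := by
  revert b; decide

theorem bowtie_adj_loopVertex_two : ∀ (b : Bool) (v : Fin 7), bowtie.Adj (loopVertex b 2) v →
    v = loopVertex b 1 ∨ v = loopVertex b 3 := by
  decide

/-- Without the two vertices opposite to `x`, the bowtie is a star centred at `x`. -/
theorem bowtie_adj_zero : ∀ v : Fin 7, v ≠ 0 → v ≠ loopVertex false 2 → v ≠ loopVertex true 2 →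
    bowtie.Adj 0 v := by
  decide

theorem loopVertex_zero (b : Bool) : loopVertex b 0 = 0 := by
  cases b <;> rfl

theorem loopVertex_injective (b : Bool) : Function.Injective (loopVertex b) := by
  revert b; decide

theorem loopVertex_two_ne_zero (b : Bool) : loopVertex b 2 ≠ 0 := by
  revert b; decide

theorem eq_of_loopVertex_two_eq : ∀ (b b' : Bool) (i : Fin 4), loopVertex b' i = loopVertex b 2 →
    b' = b := by
  decide

theorem exists_loopVertex_eq : ∀ v : Fin 7, ∃ b i, loopVertex b i = v := by
  decide

theorem bowtie_triangleFree : ∀ u v w : Fin 7, bowtie.Adj u v → bowtie.Adj u w →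
    ¬ bowtie.Adj v w := by
  decide

theorem fin_four_ne_add_one (i : Fin 4) : i ≠ i + 1 := by
  revert i; decide

theorem card_eq_two_of_loopCoeff_ne_zero {b : Bool} {e : Finset (Fin 7)} (h : loopCoeff b e ≠ 0) :
    #e = 2 := by
  obtain ⟨i, -, hi⟩ := Finset.exists_ne_zero_of_sum_ne_zero h
  split_ifs at hi with h1 h2
  · rw [h1, Finset.card_pair h2.ne]
  · rw [h1, Finset.card_pair]
    exact fun h' => fin_four_ne_add_one i (loopVertex_injective b h')
  · exact absurd rfl hi

/-- This edge avoids the shared vertex `x`, so it determines its loop, and the numbering of the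
vertices orients it positively. -/
theorem loopCoeff_pair (b b' : Bool) :
    loopCoeff b {loopVertex b' 2, loopVertex b' 3} = if b = b' then 1 else 0 := by
  rw [loopCoeff, Fin.sum_univ_four]
  cases b <;> cases b' <;> simp (decide := true)

end Bowtie

/-! ### The homology of the qubit complex -/

section Qubit

variable {m : ℕ}

instance (m : ℕ) : Fintype (QubitVertex m) := inferInstanceAs (Fintype (Fin m × Fin 7))

/-- The vertices in the copies `D` of the bowtie that lie on a loop of one of the bits `B`. -/
def qubitSet (B : Fin m → Set Bool) (D : Finset (Fin m)) : Set (QubitVertex m) :=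
  {x | (ofLex x).1 ∈ D ∧ ∃ b ∈ B (ofLex x).1, (ofLex x).2 ∈ Set.range (loopVertex b)}

/-- The join of the loops of the bits `y i` with `i ∈ D`. -/
def partialCycle (y : Fin m → Bool) (D : Finset (Fin m)) : Finset (QubitVertex m) → ℂ :=
  fun s => ∏ i, if i ∈ D then loopCoeff (y i) (block s i) else if block s i = ∅ then 1 else 0

theorem mem_block {s : Finset (QubitVertex m)} {i : Fin m} {v : Fin 7} :
    v ∈ block s i ↔ toLex (i, v) ∈ s := by
  simp [block]

theorem toLex_fst_ofLex_snd {x : QubitVertex m} {i : Fin m} (h : (ofLex x).1 = i) :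
    x = toLex (i, (ofLex x).2) := by
  subst h; rfl

/-- The join with the loop of the bit `b` in the copy `i` of the bowtie. -/
def joinLoop (i : Fin m) (b : Bool) :
    (Finset (QubitVertex m) → ℂ) →ₗ[ℂ] (Finset (QubitVertex m) → ℂ) :=
  (cre (toLex (i, loopVertex b 2)) - cre (toLex (i, loopVertex b 0))) ∘ₗ
    (cre (toLex (i, loopVertex b 3)) - cre (toLex (i, loopVertex b 1)))

/-- The factored form, a double suspension, is suited to boundaries; the expanded form lists the
four oriented edges and matches `loopCoeff`. -/
theorem joinLoop_apply (i : Fin m) (b : Bool) (c : Finset (QubitVertex m) → ℂ) :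
    joinLoop i b c = ∑ j : Fin 4,
      cre (toLex (i, loopVertex b j)) (cre (toLex (i, loopVertex b (j + 1))) c) := by
  rw [Fin.sum_univ_four]
  simp only [joinLoop, LinearMap.comp_apply, LinearMap.sub_apply, map_sub]
  have e : (3 : Fin 4) + 1 = 0 := rfl
  rw [cre_cre (toLex (i, loopVertex b 2)) (toLex (i, loopVertex b 1)),
    cre_cre (toLex (i, loopVertex b 0)) (toLex (i, loopVertex b 3)), e]
  simp only [zero_add, show (1 : Fin 4) + 1 = 2 from rfl, show (2 : Fin 4) + 1 = 3 from rfl]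
  abel

/-- Each of the two suspensions anticommutes with `bd`, and the signs cancel. -/
theorem bd_joinLoop (i : Fin m) (b : Bool) (c : Finset (QubitVertex m) → ℂ) :
    bd (joinLoop i b c) = joinLoop i b (bd c) := by
  simp only [joinLoop, LinearMap.comp_apply, LinearMap.sub_apply, bd_cre, map_sub]
  abel

/-- In the lexicographic order the vertices of one copy are consecutive. Those of other copies thus
give `u` and `v` the same sign, which cancels, and only the order of `u` and `v` matters. -/
theorem cre_cre_same_block {f : Finset (QubitVertex m) → ℂ} {i : Fin m}
    (hf : ∀ s, f s ≠ 0 → block s i = ∅) {u v : Fin 7} (huv : u ≠ v) (s : Finset (QubitVertex m)) :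
    cre (toLex (i, u)) (cre (toLex (i, v)) f) s =
      (if block s i = {u, v} then if u < v then 1 else -1 else 0) *
        f {x ∈ s | (ofLex x).1 ≠ i} := by
  have hne : (toLex (i, v) : QubitVertex m) ≠ toLex (i, u) := by
    simpa [Prod.ext_iff] using huv.symm
  rw [cre_apply, cre_apply]
  by_cases hu : (toLex (i, u) : QubitVertex m) ∈ s
  swap
  · rw [if_neg hu, if_neg, zero_mul]
    intro h
    exact hu (mem_block.1 (h ▸ by simp))
  by_cases hv : (toLex (i, v) : QubitVertex m) ∈ s
  swap
  · rw [if_pos hu, if_neg (fun h => hv (Finset.mem_of_mem_erase h)), mul_zero, if_neg, zero_mul]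
    intro h
    exact hv (mem_block.1 (h ▸ by simp))
  rw [if_pos hu, if_pos (Finset.mem_erase.2 ⟨hne, hv⟩)]
  by_cases hb : block s i = {u, v}
  · have ht : (s.erase (toLex (i, u))).erase (toLex (i, v)) = {x ∈ s | (ofLex x).1 ≠ i} := by
      ext x
      simp only [Finset.mem_erase, Finset.mem_filter]
      constructor
      · rintro ⟨h1, h2, h3⟩
        refine ⟨h3, fun h => ?_⟩
        have hx := toLex_fst_ofLex_snd h
        have : (ofLex x).2 ∈ block s i := mem_block.2 (hx ▸ h3)
        rw [hb, Finset.mem_insert, Finset.mem_singleton] at this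
        rcases this with h' | h' <;> rw [h'] at hx <;> contradiction
      · rintro ⟨h1, h2⟩
        exact ⟨by rintro rfl; exact h2 rfl, by rintro rfl; exact h2 rfl, h1⟩
    rw [ht, if_pos hb]
    set t : Finset (QubitVertex m) := {x ∈ s | (ofLex x).1 ≠ i} with htdef
    have hvt : (toLex (i, v) : QubitVertex m) ∉ t := by simp [htdef]
    have e1 : s.erase (toLex (i, u)) = insert (toLex (i, v)) t := by
      rw [← ht, Finset.insert_erase (Finset.mem_erase.2 ⟨hne, hv⟩)]
    have e2 : vertexSign t (toLex (i, u)) = vertexSign t (toLex (i, v)) := by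
      unfold vertexSign
      congr 2
      refine Finset.filter_congr fun x hx => ?_
      have hx' : (ofLex x).1 ≠ i := (Finset.mem_filter.1 hx).2
      rw [Prod.Lex.lt_iff, Prod.Lex.lt_iff]
      simp [hx']
    have e3 : ((toLex (i, v) : QubitVertex m) < toLex (i, u)) ↔ v < u := by
      rw [Prod.Lex.lt_iff]; simp
    rw [← vertexSign_erase_self s, e1, vertexSign_insert hvt, vertexSign_insert_self, e2, ← mul_assoc,
      mul_assoc (ite _ _ _), vertexSign_mul_self, mul_one]
    congr 1
    simp only [e3]
    rcases lt_or_gt_of_ne huv with h | h <;> simp [h, h.not_gt]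
  · rw [if_neg hb, zero_mul]
    have : f ((s.erase (toLex (i, u))).erase (toLex (i, v))) = 0 := by
      by_contra h
      have := hf _ h
      apply hb
      ext w
      rw [mem_block, Finset.mem_insert, Finset.mem_singleton]
      constructor
      · intro hw
        by_contra! h'
        have hw' : w ∈ block ((s.erase (toLex (i, u))).erase (toLex (i, v))) i := by
          rw [mem_block, Finset.mem_erase, Finset.mem_erase]
          refine ⟨?_, ?_, hw⟩
          · simpa [Prod.ext_iff] using h'.2
          · simpa [Prod.ext_iff] using h'.1
        rw [this] at hw'
        simp at hw'
      · rintro (rfl | rfl) <;> assumption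
    rw [this, mul_zero, mul_zero]

/-- Identifies the product formula for the join with iterated creation operators, so that statements
about `partialCycle` follow by induction on `D`. -/
theorem joinLoop_partialCycle {D : Finset (Fin m)} {i : Fin m} (hi : i ∉ D) (y : Fin m → Bool)
    (b : Bool) :
    joinLoop i b (partialCycle y D) = partialCycle (Function.update y i b) (insert i D) := by
  have hf (s) (hs : partialCycle y D s ≠ 0) : block s i = ∅ := by
    have := Finset.prod_ne_zero_iff.1 hs i (Finset.mem_univ i)
    rw [if_neg hi] at this
    by_contra h
    exact this (if_neg h)
  ext s
  rw [joinLoop_apply, Finset.sum_apply]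
  have h1 (j : Fin 4) := cre_cre_same_block hf
    (u := loopVertex b j) (v := loopVertex b (j + 1))
    (fun h => fin_four_ne_add_one j (loopVertex_injective b h)) s
  rw [Finset.sum_congr rfl fun j _ => h1 j, ← Finset.sum_mul]
  change loopCoeff b (block s i) * _ = _
  unfold partialCycle
  rw [← Finset.mul_prod_erase _ _ (Finset.mem_univ i),
    ← Finset.mul_prod_erase Finset.univ (fun j => if j ∈ insert i D then _ else _)
      (Finset.mem_univ i), if_neg hi, if_pos (by simp [block]), one_mul,
    if_pos (Finset.mem_insert_self _ _), Function.update_self]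
  congr 1
  refine Finset.prod_congr rfl fun j hj => ?_
  have hj' := Finset.ne_of_mem_erase hj
  have : block {x ∈ s | (ofLex x).1 ≠ i} j = block s j := by
    ext v; simp [mem_block, hj']
  simp [this, hj']

theorem joinLoop_partialCycle_self {D : Finset (Fin m)} {i : Fin m} (hi : i ∉ D)
    (y : Fin m → Bool) : joinLoop i (y i) (partialCycle y D) = partialCycle y (insert i D) := by
  rw [joinLoop_partialCycle hi, Function.update_eq_self]

theorem partialCycle_empty_apply (y : Fin m → Bool) (s : Finset (QubitVertex m)) :
    partialCycle y ∅ s = if s = ∅ then 1 else 0 := by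
  unfold partialCycle
  simp only [Finset.notMem_empty, if_false]
  split_ifs with h
  · subst h
    exact Finset.prod_eq_one fun i _ => if_pos (by simp [block])
  · obtain ⟨x, hx⟩ := Finset.nonempty_iff_ne_empty.2 h
    refine Finset.prod_eq_zero (Finset.mem_univ (ofLex x).1) (if_neg ?_)
    exact Finset.nonempty_iff_ne_empty.1 ⟨(ofLex x).2, mem_block.2 hx⟩

theorem bd_partialCycle (y : Fin m → Bool) (D : Finset (Fin m)) : bd (partialCycle y D) = 0 := by
  induction D using Finset.induction_on with
  | empty =>
    ext s
    simp [bdW_apply, ann_apply, partialCycle_empty_apply]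
  | insert i D hi ih => rw [← joinLoop_partialCycle_self hi, bd_joinLoop, ih, map_zero]

theorem qubitGraph_adj_of_notMem {B : Fin m → Set Bool} {D : Finset (Fin m)} {i : Fin m}
    (hi : i ∉ D) (v : Fin 7) {u : QubitVertex m} (hu : u ∈ qubitSet B D) :
    (qubitGraph m).Adj (toLex (i, v)) u :=
  Or.inl fun h => hi (by rw [show i = (ofLex u).1 from h]; exact hu.1)

theorem qubitGraph_adj_same {i : Fin m} {u v : Fin 7} :
    (qubitGraph m).Adj (toLex (i, u)) (toLex (i, v)) ↔ bowtie.Adj u v := by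
  simp [qubitGraph]

theorem mem_qubitSet_insert {B : Fin m → Set Bool} {D : Finset (Fin m)} {i : Fin m} {b : Bool}
    (hb : b ∈ B i) (j : Fin 4) :
    (toLex (i, loopVertex b j) : QubitVertex m) ∈ qubitSet B (insert i D) :=
  ⟨Finset.mem_insert_self _ _, b, hb, j, rfl⟩

theorem qubitSet_subset_insert (B : Fin m → Set Bool) (D : Finset (Fin m)) (i : Fin m) :
    qubitSet B D ⊆ qubitSet B (insert i D) :=
  fun _ h => ⟨Finset.mem_insert_of_mem h.1, h.2⟩

/-- The vertices in the copies `D` and the two vertices at distance one from `x` on the loop of `b`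
in the copy `i`. -/
def linkSet (B : Fin m → Set Bool) (D : Finset (Fin m)) (i : Fin m) (b : Bool) :
    Set (QubitVertex m) :=
  insert (toLex (i, loopVertex b 1)) (insert (toLex (i, loopVertex b 3)) (qubitSet B D))

variable {B : Fin m → Set Bool} {D : Finset (Fin m)} {i : Fin m} {b : Bool}

/-- Both poles, `x` and the vertex opposite to it, are adjacent to all of `linkSet`. -/
theorem cre_sub_cre_mem (hi : i ∉ D) (hb : b ∈ B i) {c : Finset (QubitVertex m) → ℂ}
    (hc : c ∈ cliqueChains (qubitGraph m) (linkSet B D i b)) :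
    cre (toLex (i, loopVertex b 2)) c - cre (toLex (i, loopVertex b 0)) c ∈
      cliqueChains (qubitGraph m) (qubitSet B (insert i D)) := by
  obtain ⟨h1, h2, h3, h4, -⟩ := bowtie_adj_loopVertex b
  have hsub : linkSet B D i b ⊆ qubitSet B (insert i D) :=
    Set.insert_subset (mem_qubitSet_insert hb _) (Set.insert_subset (mem_qubitSet_insert hb _)
      (qubitSet_subset_insert _ _ _))
  refine Submodule.sub_mem _ (cre_mem_cliqueChains hc (mem_qubitSet_insert hb _) hsub ?_)
    (cre_mem_cliqueChains hc (mem_qubitSet_insert hb _) hsub ?_)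
  · rintro u (rfl | rfl | hu) -
    · exact qubitGraph_adj_same.2 h1
    · exact qubitGraph_adj_same.2 h2
    · exact qubitGraph_adj_of_notMem hi _ hu
  · rintro u (rfl | rfl | hu) -
    · exact qubitGraph_adj_same.2 h3
    · exact qubitGraph_adj_same.2 h4
    · exact qubitGraph_adj_of_notMem hi _ hu

theorem cre_mem_linkSet (hi : i ∉ D) {c : Finset (QubitVertex m) → ℂ}
    (hc : c ∈ cliqueChains (qubitGraph m) (qubitSet B D)) :
    cre (toLex (i, loopVertex b 3)) c ∈ cliqueChains (qubitGraph m) (linkSet B D i b) ∧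
    cre (toLex (i, loopVertex b 1)) c ∈ cliqueChains (qubitGraph m) (linkSet B D i b) := by
  have hsub : qubitSet B D ⊆ linkSet B D i b :=
    fun _ h => Set.mem_insert_of_mem _ (Set.mem_insert_of_mem _ h)
  exact ⟨cre_mem_cliqueChains hc (by simp [linkSet]) hsub
      fun u hu _ => qubitGraph_adj_of_notMem hi _ hu,
    cre_mem_cliqueChains hc (by simp [linkSet]) hsub
      fun u hu _ => qubitGraph_adj_of_notMem hi _ hu⟩

theorem joinLoop_mem (hi : i ∉ D) (hb : b ∈ B i) {c : Finset (QubitVertex m) → ℂ}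
    (hc : c ∈ cliqueChains (qubitGraph m) (qubitSet B D)) :
    joinLoop i b c ∈ cliqueChains (qubitGraph m) (qubitSet B (insert i D)) := by
  obtain ⟨h3, h1⟩ := cre_mem_linkSet (b := b) hi hc
  exact cre_sub_cre_mem hi hb (Submodule.sub_mem _ h3 h1)

theorem partialCycle_mem {y : Fin m → Bool} (hy : ∀ i, y i ∈ B i) (D : Finset (Fin m)) :
    partialCycle y D ∈ cliqueChains (qubitGraph m) (qubitSet B D) := by
  induction D using Finset.induction_on with
  | empty =>
    intro s hs
    rw [partialCycle_empty_apply] at hs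
    split_ifs at hs with h
    · subst h; simp
    · exact absurd rfl hs
  | insert i D hi ih =>
    rw [← joinLoop_partialCycle_self hi]
    exact joinLoop_mem hi (hy i) ih

variable (B D) in
/-- The span of the joins of loops and of the boundaries. -/
def loopsAndBoundaries : Submodule ℂ (Finset (QubitVertex m) → ℂ) :=
  Submodule.span ℂ ((partialCycle · D) '' {y | ∀ i, y i ∈ B i}) ⊔
    (cliqueChains (qubitGraph m) (qubitSet B D)).map bd

/-- Joining with a loop takes joins of loops to joins of loops and commutes with `bd`. -/
theorem joinLoop_mem_loopsAndBoundaries (hi : i ∉ D) (hb : b ∈ B i)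
    {c : Finset (QubitVertex m) → ℂ} (hc : c ∈ loopsAndBoundaries B D) :
    joinLoop i b c ∈ loopsAndBoundaries B (insert i D) := by
  suffices h : loopsAndBoundaries B D ≤ (loopsAndBoundaries B (insert i D)).comap (joinLoop i b) from
    h hc
  refine sup_le (Submodule.span_le.2 ?_) (Submodule.map_le_iff_le_comap.2 fun g hg => ?_)
  · rintro _ ⟨y, hy, rfl⟩
    refine Submodule.mem_sup_left (Submodule.subset_span ⟨Function.update y i b, fun j => ?_,
      (joinLoop_partialCycle hi y b).symm⟩)
    by_cases hj : j = i
    · subst hj; simpa using hb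
    · simpa [hj] using hy j
  · refine Submodule.mem_sup_right ⟨_, joinLoop_mem hi hb hg, bd_joinLoop i b g⟩

/-- `linkSet` spans a suspension with poles `v` and `w`. Up to a cycle `e` in the cone with apex
`w`, which bounds, `c` is the suspension of the cycle `ann v c` on the copies `D`. Suspending once
more turns that into a join with the loop, to which `ih` applies. -/
theorem link_mem_loopsAndBoundaries (hi : i ∉ D) (hb : b ∈ B i)
    (ih : ∀ c ∈ cliqueChains (qubitGraph m) (qubitSet B D), bd c = 0 → c ∈ loopsAndBoundaries B D)
    {c : Finset (QubitVertex m) → ℂ} (hc : c ∈ cliqueChains (qubitGraph m) (linkSet B D i b))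
    (hc0 : bd c = 0) :
    cre (toLex (i, loopVertex b 2)) c - cre (toLex (i, loopVertex b 0)) c ∈
      loopsAndBoundaries B (insert i D) := by
  set v : QubitVertex m := toLex (i, loopVertex b 3) with hv
  set w : QubitVertex m := toLex (i, loopVertex b 1) with hw
  have hvw : v ≠ w := by
    intro h
    have : loopVertex b 3 = loopVertex b 1 := by simpa [hv, hw] using h
    exact absurd (loopVertex_injective b this) (by decide)
  have hd : ann v c ∈ cliqueChains (qubitGraph m) (qubitSet B D) := by
    refine cliqueChains_mono ?_ (ann_mem_cliqueChains hc v)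
    rintro u ⟨rfl | rfl | hu, hadj⟩
    · exact ((bowtie_adj_loopVertex b).2.2.2.2 (qubitGraph_adj_same.1 hadj)).elim
    · exact (hadj.ne rfl).elim
    · exact hu
  have hd0 := bd_ann_eq_zero hc0 v
  -- the rest is a cycle in the cone with apex `w`
  have he : c - cre v (ann v c) + cre w (ann v c) ∈
      cliqueChains (qubitGraph m) (insert w (qubitSet B D)) := by
    refine Submodule.add_mem _
      (cliqueChains_mono ?_ (sub_cre_ann_mem_cliqueChains hc v))
      (cre_mem_cliqueChains hd (Set.mem_insert _ _) (Set.subset_insert _ _)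
        fun u hu _ => qubitGraph_adj_of_notMem hi _ hu)
    rintro u ⟨rfl | rfl | hu, hne⟩
    · exact Set.mem_insert _ _
    · exact (hne rfl).elim
    · exact Set.mem_insert_of_mem _ hu
  set e := c - cre v (ann v c) + cre w (ann v c) with hedef
  have he0 : bd e = 0 := by
    rw [hedef, map_add, map_sub, bd_cre, bd_cre, hd0, hc0]
    simp
  have hwe : cre w e ∈ cliqueChains (qubitGraph m) (linkSet B D i b) := by
    refine cre_mem_cliqueChains he (Set.mem_insert _ _)
      (Set.insert_subset_insert (Set.subset_insert _ _)) ?_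
    rintro u (rfl | hu) hne
    · exact (hne rfl).elim
    · exact qubitGraph_adj_of_notMem hi _ hu
  have hsplit : c = e + (cre v (ann v c) - cre w (ann v c)) := by rw [hedef]; abel
  have h1 : cre (toLex (i, loopVertex b 2)) e - cre (toLex (i, loopVertex b 0)) e ∈
      loopsAndBoundaries B (insert i D) := by
    refine Submodule.mem_sup_right ⟨_, Submodule.neg_mem _ (cre_sub_cre_mem hi hb hwe), ?_⟩
    rw [map_neg, bd_cre_sub_cre, neg_neg, bd_cre_of_bd_eq_zero w he0]
  have h2 := joinLoop_mem_loopsAndBoundaries hi hb (ih _ hd hd0)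
  have h3 := Submodule.add_mem _ h1 h2
  convert h3 using 1
  conv_lhs => rw [hsplit]
  simp only [joinLoop, LinearMap.comp_apply, LinearMap.sub_apply, map_add, map_sub, ← hv, ← hw]
  abel

/-- Clears a cycle of the vertex opposite to `x` by subtracting the suspension of its link part with
that vertex and `x` as poles. The set `X` is arbitrary because this is done for the two bits in
succession. -/
theorem exists_sub_mem_loopsAndBoundaries (hi : i ∉ D) (b : Bool)
    (ih : ∀ c ∈ cliqueChains (qubitGraph m) (qubitSet B D), bd c = 0 → c ∈ loopsAndBoundaries B D)
    {X : Set (QubitVertex m)} (hX : X ⊆ qubitSet B (insert i D)) (hx : toLex (i, 0) ∈ X)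
    {c : Finset (QubitVertex m) → ℂ} (hc : c ∈ cliqueChains (qubitGraph m) X) (hc0 : bd c = 0) :
    ∃ c' ∈ cliqueChains (qubitGraph m) (X \ {toLex (i, loopVertex b 2)}), bd c' = 0 ∧
      c - c' ∈ loopsAndBoundaries B (insert i D) := by
  set v : QubitVertex m := toLex (i, loopVertex b 2) with hv
  by_cases hb : b ∈ B i
  · have hsub : {u ∈ X | (qubitGraph m).Adj v u} ⊆ linkSet B D i b := by
      rintro u ⟨hu, hadj⟩
      by_cases hui : (ofLex u).1 = i
      · rw [toLex_fst_ofLex_snd hui] at hadj ⊢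
        rcases bowtie_adj_loopVertex_two _ _ (qubitGraph_adj_same.1 hadj) with h | h <;> rw [h]
        · exact Set.mem_insert _ _
        · exact Set.mem_insert_of_mem _ (Set.mem_insert _ _)
      · obtain ⟨h1, h2⟩ := hX hu
        exact Set.mem_insert_of_mem _ (Set.mem_insert_of_mem _
          ⟨Finset.mem_of_mem_insert_of_ne h1 hui, h2⟩)
    have hd := ann_mem_cliqueChains hc v
    have hd0 := bd_ann_eq_zero hc0 v
    refine ⟨c - (cre v (ann v c) - cre (toLex (i, loopVertex b 0)) (ann v c)), ?_, ?_, ?_⟩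
    · rw [← sub_add]
      refine Submodule.add_mem _ (sub_cre_ann_mem_cliqueChains hc v)
        (cre_mem_cliqueChains hd ⟨loopVertex_zero b ▸ hx, ?_⟩
          (fun u hu => ⟨hu.1, fun h => hu.2.ne h.symm⟩) fun u hu _ => ?_)
      · intro h
        have : loopVertex b 0 = loopVertex b 2 := by simpa [hv] using h
        exact absurd (loopVertex_injective b this) (by decide)
      · obtain ⟨-, -, h3, h4, -⟩ := bowtie_adj_loopVertex b
        rcases hsub hu with rfl | rfl | hu
        · exact qubitGraph_adj_same.2 h3
        · exact qubitGraph_adj_same.2 h4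
        · exact qubitGraph_adj_of_notMem hi _ hu
    · rw [map_sub, bd_cre_sub_cre, hd0, hc0]; simp
    · rw [sub_sub_cancel]
      exact link_mem_loopsAndBoundaries hi hb ih (cliqueChains_mono hsub hd) hd0
  -- The vertex opposite to `x` lies on one loop only, so it is absent when its bit is not allowed.
  · have hvX : v ∉ X := fun hvX => by
      obtain ⟨-, b', hb', j, hj⟩ := hX hvX
      exact hb (eq_of_loopVertex_two_eq b b' j hj ▸ hb')
    exact ⟨c, (Set.sdiff_singleton_eq_self hvX).symm ▸ hc, hc0, by simp⟩

/-- The homology is spanned by the classes of the joins of loops. -/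
theorem mem_loopsAndBoundaries (hB : ∀ i, (B i).Nonempty) (D : Finset (Fin m)) :
    ∀ c ∈ cliqueChains (qubitGraph m) (qubitSet B D), bd c = 0 → c ∈ loopsAndBoundaries B D := by
  induction D using Finset.induction_on with
  | empty =>
    intro c hc _
    choose y hy using hB
    -- Over no copies the only simplex is the empty one, and the choice of `y` is immaterial.
    have : c = c ∅ • partialCycle y ∅ := by
      ext s
      rw [Pi.smul_apply, partialCycle_empty_apply]
      split_ifs with h
      · simp [h]
      · by_contra h'
        obtain ⟨x, hx⟩ := Finset.nonempty_iff_ne_empty.2 h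
        have := (hc s (by simpa using h')).1 hx
        simp [qubitSet] at this
    rw [this]
    exact Submodule.mem_sup_left (Submodule.smul_mem _ _ (Submodule.subset_span ⟨y, hy, rfl⟩))
  | insert i D hi ih =>
    intro c hc hc0
    have hx : (toLex (i, 0) : QubitVertex m) ∈ qubitSet B (insert i D) := by
      obtain ⟨b, hb⟩ := hB i
      exact loopVertex_zero b ▸ mem_qubitSet_insert hb 0
    -- After both opposite vertices are cleared, the copy `i` is a star, so `c₂` lies in a cone with
    -- apex `x` and bounds.
    obtain ⟨c₁, hc₁, hc₁0, h₁⟩ := exists_sub_mem_loopsAndBoundaries hi false ih subset_rfl hx hc hc0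
    obtain ⟨c₂, hc₂, hc₂0, h₂⟩ := exists_sub_mem_loopsAndBoundaries hi true ih
      Set.sdiff_subset ⟨hx, by simpa using (loopVertex_two_ne_zero false).symm⟩ hc₁ hc₁0
    have h₃ : c₂ ∈ loopsAndBoundaries B (insert i D) := by
      refine Submodule.mem_sup_right ⟨cre (toLex (i, 0)) c₂, ?_, bd_cre_of_bd_eq_zero _ hc₂0⟩
      refine cre_mem_cliqueChains hc₂ hx (Set.sdiff_subset.trans Set.sdiff_subset) ?_
      rintro u ⟨⟨hu, hf⟩, ht⟩ hne
      by_cases hui : (ofLex u).1 = i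
      · rw [toLex_fst_ofLex_snd hui] at hf ht hne ⊢
        refine qubitGraph_adj_same.2 (bowtie_adj_zero _ ?_ ?_ ?_)
        · simpa using hne
        · simpa using hf
        · simpa using ht
      · exact Or.inl (Ne.symm hui)
    have := Submodule.add_mem _ (Submodule.add_mem _ h₁ h₂) h₃
    simpa using this

/-! ### Top dimension and linear independence of the joins of loops -/

theorem card_eq_sum_block (s : Finset (QubitVertex m)) : #s = ∑ i, #(block s i) := by
  rw [Finset.card_eq_sum_card_fiberwise (f := fun x => (ofLex x).1) (t := Finset.univ)
    fun _ _ => Finset.mem_coe.2 (Finset.mem_univ _)]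
  refine Finset.sum_congr rfl fun i _ => ?_
  refine Finset.card_bij' (fun x _ => (ofLex x).2) (fun v _ => toLex (i, v)) ?_ ?_ ?_ ?_
  · intro x hx
    rw [Finset.mem_filter] at hx
    exact mem_block.2 (toLex_fst_ofLex_snd hx.2 ▸ hx.1)
  · intro v hv
    exact Finset.mem_filter.2 ⟨mem_block.1 hv, rfl⟩
  · intro x hx
    exact (toLex_fst_ofLex_snd (Finset.mem_filter.1 hx).2).symm
  · intro v _
    rfl

/-- A clique meets each copy in at most two vertices, as the bowtie has no triangle. -/
theorem card_le_of_isClique {s : Finset (QubitVertex m)}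
    (hs : (qubitGraph m).IsClique (s : Set (QubitVertex m))) : #s ≤ 2 * m := by
  rw [card_eq_sum_block]
  refine (Finset.sum_le_card_nsmul _ _ 2 fun i _ => ?_).trans (by simp [mul_comm])
  by_contra! h
  obtain ⟨u, v, w, hu, hv, hw, huv, huw, hvw⟩ := Finset.two_lt_card_iff.1 h
  have key {a b : Fin 7} (ha : a ∈ block s i) (hb : b ∈ block s i) (hab : a ≠ b) :
      bowtie.Adj a b :=
    qubitGraph_adj_same.1 (hs (mem_block.1 ha) (mem_block.1 hb) (by simpa using hab))
  exact bowtie_triangleFree u v w (key hu hv huv) (key hu hw huw) (key hv hw hvw)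

theorem card_eq_of_partialCycle_ne_zero {y : Fin m → Bool} {s : Finset (QubitVertex m)}
    (h : partialCycle y Finset.univ s ≠ 0) : #s = 2 * m := by
  rw [card_eq_sum_block, Finset.sum_const_nat (m := 2)]
  · simp [mul_comm]
  · intro i _
    have := Finset.prod_ne_zero_iff.1 h i (Finset.mem_univ i)
    rw [if_pos (Finset.mem_univ i)] at this
    exact card_eq_two_of_loopCoeff_ne_zero this

/-- A facet that belongs to the cycle of the bits `y` and to no other one. -/
def facet (y : Fin m → Bool) : Finset (QubitVertex m) :=
  {x | (ofLex x).2 ∈ ({loopVertex (y (ofLex x).1) 2, loopVertex (y (ofLex x).1) 3} : Finset _)}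

theorem block_facet (y : Fin m → Bool) (i : Fin m) :
    block (facet y) i = {loopVertex (y i) 2, loopVertex (y i) 3} := by
  ext v; simp [mem_block, facet]

theorem partialCycle_facet (y y' : Fin m → Bool) :
    partialCycle y Finset.univ (facet y') = if y = y' then 1 else 0 := by
  simp only [partialCycle, Finset.mem_univ, if_true, block_facet, loopCoeff_pair]
  split_ifs with h
  · exact Finset.prod_eq_one fun i _ => if_pos (congrFun h i)
  · obtain ⟨i, hi⟩ := Function.ne_iff.1 h
    exact Finset.prod_eq_zero (Finset.mem_univ i) (if_neg hi)

/-- The classes of the joins of loops are linearly independent. -/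
theorem eq_zero_of_sum_partialCycle_eq_bd {a : (Fin m → Bool) → ℂ}
    {b : Finset (QubitVertex m) → ℂ} {S : Set (QubitVertex m)}
    (hb : b ∈ cliqueChains (qubitGraph m) S)
    (h : ∑ y, a y • partialCycle y Finset.univ = bd b) (y : Fin m → Bool) : a y = 0 := by
  have hcard : #(facet y) = 2 * m :=
    card_eq_of_partialCycle_ne_zero (y := y) (by rw [partialCycle_facet, if_pos rfl]; simp)
  -- The facet already has the maximal number of vertices, so no simplex has it as a proper face.
  have h1 : bd b (facet y) = 0 := by
    rw [bdW_apply, Finset.sum_apply]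
    refine Finset.sum_eq_zero fun v _ => ?_
    rw [one_smul, ann_apply]
    split_ifs with hv
    · rfl
    · by_contra h'
      have := card_le_of_isClique (hb _ (right_ne_zero_of_mul h')).2
      rw [Finset.card_insert_of_notMem hv] at this
      omega
  rw [← h, Finset.sum_apply] at h1
  simpa [partialCycle_facet] using h1

end Qubit

/-! ### The glued complex is a clique complex -/

section GadgetGraph

variable {V : Type*}

/-- The inclusion of `V` as the inner layer. -/
def innerLayer (v : V) : WithTop (Layered V) := ((toLex (1, v) : Layered V) : WithTop (Layered V))

/-- The map that exchanges the two layers. -/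
def swapLayer (x : WithTop (Layered V)) : WithTop (Layered V) :=
  x.map fun a => toLex (1 - (ofLex a).1, (ofLex a).2)

@[simp] theorem inner_inj {u v : V} : innerLayer u = innerLayer v ↔ u = v := by
  simp [innerLayer, WithTop.coe_inj]

@[simp] theorem inner_ne_top (u : V) : innerLayer u ≠ ⊤ := WithTop.coe_ne_top

@[simp] theorem top_ne_inner (u : V) : ⊤ ≠ innerLayer u := WithTop.top_ne_coe

variable [LinearOrder V]

theorem outer_apply (v : V) :
    outer V v = ((toLex (0, v) : Layered V) : WithTop (Layered V)) := rfl

theorem swapLayer_outer (v : V) : swapLayer (outer V v) = innerLayer v := by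
  simp [swapLayer, innerLayer, outer_apply]

theorem swapLayer_inner (v : V) : swapLayer (innerLayer v) = outer V v := by
  simp [swapLayer, innerLayer, outer_apply]

@[simp] theorem outer_ne_inner (u v : V) : outer V u ≠ innerLayer v := by
  simp [innerLayer, outer_apply, WithTop.coe_inj]

@[simp] theorem inner_ne_outer (u v : V) : innerLayer v ≠ outer V u := (outer_ne_inner u v).symm

@[simp] theorem outer_ne_top (u : V) : outer V u ≠ ⊤ := WithTop.coe_ne_top

@[simp] theorem top_ne_outer (u : V) : ⊤ ≠ outer V u := WithTop.top_ne_coe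

theorem layered_cases (a : Layered V) :
    ((ofLex a).1 = 0 ∧ (a : WithTop (Layered V)) = outer V (ofLex a).2) ∨
      ((ofLex a).1 = 1 ∧ (a : WithTop (Layered V)) = innerLayer (ofLex a).2) := by
  rcases Fin.exists_fin_two.1 ⟨(ofLex a).1, rfl⟩ with h | h
  · exact Or.inl ⟨h, by rw [outer_apply, ← h]; rfl⟩
  · exact Or.inr ⟨h, by rw [innerLayer, ← h]; rfl⟩

theorem gadget_cases (x : WithTop (Layered V)) :
    x = ⊤ ∨ (∃ v, x = outer V v) ∨ ∃ v, x = innerLayer v := by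
  induction x using WithTop.recTopCoe with
  | top => exact Or.inl rfl
  | coe a =>
    rcases layered_cases a with h | h
    · exact Or.inr (Or.inl ⟨_, h.2⟩)
    · exact Or.inr (Or.inr ⟨_, h.2⟩)

variable (G : SimpleGraph V) (T : Set V) (r : V → V → Prop)

/-- The edges of the glued complex, in one direction. -/
def gadgetRel (x y : WithTop (Layered V)) : Prop :=
  (∃ u v, x = outer V u ∧ y = outer V v ∧ G.Adj u v) ∨
  (∃ u v, x = innerLayer u ∧ y = innerLayer v ∧ G.Adj u v) ∨
  (∃ u v, x = outer V u ∧ y = innerLayer v ∧ u ∈ T ∧ v ∈ T ∧ (u = v ∨ (G.Adj u v ∧ r u v))) ∨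
  (∃ v, x = innerLayer v ∧ y = ⊤)

/-- The graph whose clique complex is the glued complex. -/
def gadgetGraph : SimpleGraph (WithTop (Layered V)) where
  Adj x y := gadgetRel G T r x y ∨ gadgetRel G T r y x
  symm := ⟨fun _ _ h => h.symm⟩
  loopless := ⟨fun x h => by
    have h' := or_self_iff.1 h
    rcases gadget_cases x with rfl | ⟨v, rfl⟩ | ⟨v, rfl⟩ <;> simp [gadgetRel] at h'⟩

/-- The vertices of the glued complex. -/
def gadgetVertices : Set (WithTop (Layered V)) :=
  Set.range (outer V) ∪ innerLayer '' T ∪ {⊤}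

variable {G T r}

theorem gadgetGraph_outer_outer {u v : V} :
    (gadgetGraph G T r).Adj (outer V u) (outer V v) ↔ G.Adj u v := by
  simp [gadgetGraph, gadgetRel, G.adj_comm v u]

/-- `T` does not enter here; it is `gadgetVertices` that confines the inner vertices to `T`. -/
theorem gadgetGraph_inner_inner {u v : V} :
    (gadgetGraph G T r).Adj (innerLayer u) (innerLayer v) ↔ G.Adj u v := by
  simp [gadgetGraph, gadgetRel, G.adj_comm v u]

theorem gadgetGraph_outer_inner {u v : V} : (gadgetGraph G T r).Adj (outer V u) (innerLayer v) ↔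
    u ∈ T ∧ v ∈ T ∧ (u = v ∨ (G.Adj u v ∧ r u v)) := by
  simp [gadgetGraph, gadgetRel]

theorem gadgetGraph_top_inner (v : V) : (gadgetGraph G T r).Adj ⊤ (innerLayer v) := by
  simp [gadgetGraph, gadgetRel]

theorem gadgetGraph_top_outer (v : V) : ¬ (gadgetGraph G T r).Adj ⊤ (outer V v) := by
  simp [gadgetGraph, gadgetRel]

@[simp] theorem outer_mem_gadgetVertices (v : V) : outer V v ∈ gadgetVertices T := by
  simp [gadgetVertices]

@[simp] theorem inner_mem_gadgetVertices {v : V} : innerLayer v ∈ gadgetVertices T ↔ v ∈ T := by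
  simp [gadgetVertices]

@[simp] theorem top_mem_gadgetVertices : ⊤ ∈ gadgetVertices T := by
  simp [gadgetVertices]

/-- The image of a set of layered vertices. -/
local notation "up" τ => Finset.image (fun x : Layered V => (x : WithTop (Layered V))) τ

/-- Both conditions on a simplex of the thickening, a clique as projection and the order between the
layers, concern pairs of vertices only. -/
theorem thickening_face_iff {τ : Finset (Layered V)} (hτ : τ.Nonempty) :
    τ ∈ (thickening (cliqueComplexOn T G) r).faces ↔ (∀ x ∈ τ, (ofLex x).2 ∈ T) ∧
      (gadgetGraph G T r).IsClique ((up τ : Finset _) : Set (WithTop (Layered V))) := by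
  constructor
  · rintro ⟨⟨-, hT, hG⟩, hr⟩
    rw [Finset.coe_image] at hT hG
    have hT' : ∀ x ∈ τ, (ofLex x).2 ∈ T := fun x hx => hT ⟨x, hx, rfl⟩
    refine ⟨hT', ?_⟩
    rw [Finset.coe_image]
    rintro _ ⟨x, hx, rfl⟩ _ ⟨y, hy, rfl⟩ hxy
    have hadj (h : (ofLex x).2 ≠ (ofLex y).2) := hG ⟨x, hx, rfl⟩ ⟨y, hy, rfl⟩ h
    dsimp only at hxy ⊢
    rcases layered_cases x with ⟨hx0, hx'⟩ | ⟨hx0, hx'⟩ <;>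
    rcases layered_cases y with ⟨hy0, hy'⟩ | ⟨hy0, hy'⟩ <;> rw [hx', hy'] at hxy ⊢
    · exact gadgetGraph_outer_outer.2 (hadj fun h => hxy (by rw [h]))
    · refine gadgetGraph_outer_inner.2 ⟨hT' x hx, hT' y hy, ?_⟩
      by_cases h : (ofLex x).2 = (ofLex y).2
      · exact Or.inl h
      · exact Or.inr ⟨hadj h, (hr x hx y hy hx0 hy0).resolve_left h⟩
    · refine (gadgetGraph_outer_inner.2 ⟨hT' y hy, hT' x hx, ?_⟩).symm
      by_cases h : (ofLex y).2 = (ofLex x).2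
      · exact Or.inl h
      · exact Or.inr ⟨(hadj (Ne.symm h)).symm, (hr y hy x hx hy0 hx0).resolve_left h⟩
    · exact gadgetGraph_inner_inner.2 (hadj fun h => hxy (by rw [h]))
  · rintro ⟨hT, hG⟩
    have hadj {x y} (hx : x ∈ τ) (hy : y ∈ τ) (hxy : x ≠ y) :
        (gadgetGraph G T r).Adj (x : WithTop (Layered V)) y :=
      hG (by simpa using hx) (by simpa using hy) (by simpa using hxy)
    refine ⟨⟨hτ.image _, ?_, ?_⟩, ?_⟩
    · rw [Finset.coe_image]
      rintro _ ⟨x, hx, rfl⟩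
      exact hT x hx
    · rw [Finset.coe_image]
      rintro _ ⟨x, hx, rfl⟩ _ ⟨y, hy, rfl⟩ hxy
      dsimp only at hxy ⊢
      have h := hadj hx hy (fun h => hxy (by rw [h]))
      rcases layered_cases x with ⟨-, hx'⟩ | ⟨-, hx'⟩ <;>
      rcases layered_cases y with ⟨-, hy'⟩ | ⟨-, hy'⟩ <;> rw [hx', hy'] at h
      · exact gadgetGraph_outer_outer.1 h
      · exact ((gadgetGraph_outer_inner.1 h).2.2.resolve_left hxy).1
      · exact ((gadgetGraph_outer_inner.1 h.symm).2.2.resolve_left hxy.symm).1.symm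
      · exact gadgetGraph_inner_inner.1 h
    · intro x hx y hy hx0 hy1
      have h := hadj hx hy (by rintro rfl; rw [hx0] at hy1; exact absurd hy1 (by decide))
      rcases layered_cases x with ⟨-, hx'⟩ | ⟨hx1, -⟩
      · rcases layered_cases y with ⟨hy0, -⟩ | ⟨-, hy'⟩
        · rw [hy0] at hy1; exact absurd hy1 (by decide)
        · rw [hx', hy'] at h
          exact (gadgetGraph_outer_inner.1 h).2.2.imp_right And.right
      · rw [hx0] at hx1; exact absurd hx1 (by decide)

theorem up_subset_gadgetVertices {τ : Finset (Layered V)} (h : ∀ x ∈ τ, (ofLex x).2 ∈ T) :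
    ((up τ : Finset _) : Set (WithTop (Layered V))) ⊆ gadgetVertices T := by
  rw [Finset.coe_image]
  rintro _ ⟨x, hx, rfl⟩
  dsimp only
  rcases layered_cases x with ⟨-, hx'⟩ | ⟨-, hx'⟩ <;> rw [hx']
  · simp
  · simpa using h x hx

/-- A clique through `⊤` has only inner vertices besides. One without `⊤` but with an inner vertex
lies over `T`, as edges between the layers have both ends over `T`. One with outer vertices only is
a clique of `G`. -/
theorem gluedComplex_eq_cliqueComplexOn :
    gluedComplex (cliqueComplexOn Set.univ G) (cliqueComplexOn T G) r =
      cliqueComplexOn (gadgetVertices T) (gadgetGraph G T r) := by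
  refine PreAbstractSimplicialComplex.ext (Set.ext fun s => ⟨?_, ?_⟩)
  · have key (τ) (hτ : τ ∈ (thickening (cliqueComplexOn T G) r).faces) :
        (up τ) ∈ (cliqueComplexOn (gadgetVertices T) (gadgetGraph G T r)).faces := by
      have hne := ((thickening (cliqueComplexOn T G) r).isRelLowerSet_faces hτ).1
      obtain ⟨h1, h2⟩ := (thickening_face_iff hne).1 hτ
      exact ⟨hne.image _, up_subset_gadgetVertices h1, h2⟩
    rintro (⟨q, ⟨hq0, -, hq⟩, rfl⟩ | ⟨τ, hτ, rfl⟩ | ⟨τ, hτ, hin, rfl⟩)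
    · refine ⟨hq0.image _, ?_, ?_⟩
      · rw [Finset.coe_image]
        rintro _ ⟨x, -, rfl⟩
        exact outer_mem_gadgetVertices x
      · rw [Finset.coe_image]
        rintro _ ⟨x, hx, rfl⟩ _ ⟨y, hy, rfl⟩ hxy
        exact gadgetGraph_outer_outer.2 (hq hx hy fun h => hxy (by rw [h]))
    · exact key τ hτ
    · have h' : ((up τ : Finset _) : Set (WithTop (Layered V))) ⊆ gadgetVertices T ∧
          (gadgetGraph G T r).IsClique ((up τ : Finset _) : Set (WithTop (Layered V))) := by
        rcases hτ with rfl | hτ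
        · simp
        · exact (key τ hτ).2
      refine ⟨Finset.insert_nonempty _ _, ?_, ?_⟩
      · rw [Finset.coe_insert]
        exact Set.insert_subset top_mem_gadgetVertices h'.1
      · rw [Finset.coe_insert, SimpleGraph.isClique_insert]
        refine ⟨h'.2, ?_⟩
        rw [Finset.coe_image]
        rintro _ ⟨x, hx, rfl⟩ -
        rcases layered_cases x with ⟨hx0, -⟩ | ⟨-, hx'⟩
        · have h1 : (ofLex x).1 = 1 := hin x hx
          rw [hx0] at h1
          exact absurd h1 (by decide)
        · dsimp only
          rw [hx']
          exact gadgetGraph_top_inner _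
  · rintro ⟨hne, hS, hG⟩
    set τ : Finset (Layered V) :=
      s.preimage (fun x => (x : WithTop (Layered V))) (WithTop.coe_injective.injOn) with hτ
    have hmem (x) : x ∈ τ ↔ (x : WithTop (Layered V)) ∈ s := Finset.mem_preimage
    have hup : (up τ) = s.erase ⊤ := by
      ext x
      induction x using WithTop.recTopCoe with
      | top => simp
      | coe a => simp [hmem]
    have hG' : (gadgetGraph G T r).IsClique ((up τ : Finset _) : Set (WithTop (Layered V))) := by
      rw [hup]; exact hG.subset (by simp)
    by_cases htop : ⊤ ∈ s
    · have hin (x) (hx : x ∈ τ) : (ofLex x).1 = 1 ∧ (ofLex x).2 ∈ T := by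
        have hx' := (hmem x).1 hx
        have h := hG htop hx' WithTop.top_ne_coe
        rcases layered_cases x with ⟨-, hxo⟩ | ⟨h1, hxi⟩
        · rw [hxo] at h
          exact (gadgetGraph_top_outer _ h).elim
        · refine ⟨h1, ?_⟩
          have := hS hx'
          rwa [hxi, inner_mem_gadgetVertices] at this
      refine Or.inr (Or.inr ⟨τ, ?_, fun x hx => (hin x hx).1, ?_⟩)
      · rcases τ.eq_empty_or_nonempty with h | h
        · exact Or.inl h
        · exact Or.inr ((thickening_face_iff h).2 ⟨fun x hx => (hin x hx).2, hG'⟩)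
      · rw [hup, Finset.insert_erase htop]
    · rw [Finset.erase_eq_of_notMem htop] at hup
      by_cases hi : ∃ v, innerLayer v ∈ s
      · obtain ⟨v, hv⟩ := hi
        have hvT : v ∈ T := inner_mem_gadgetVertices.1 (hS hv)
        refine Or.inr (Or.inl ⟨τ, ?_, hup.symm⟩)
        refine (thickening_face_iff ?_).2 ⟨fun x hx => ?_, hG'⟩
        · rw [← Finset.image_nonempty (f := fun x : Layered V => (x : WithTop (Layered V))), hup]
          exact hne
        · have hx' := (hmem x).1 hx
          rcases layered_cases x with ⟨-, hxo⟩ | ⟨-, hxi⟩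
          · rw [hxo] at hx'
            exact (gadgetGraph_outer_inner.1 (hG hx' hv (outer_ne_inner _ _))).1
          · rw [hxi] at hx'
            exact inner_mem_gadgetVertices.1 (hS hx')
      · refine Or.inl ⟨s.preimage (outer V) (outer V).injective.injOn, ⟨?_, ?_, ?_⟩, ?_⟩
        rotate_left 3
        · ext x
          rcases gadget_cases x with rfl | ⟨v, rfl⟩ | ⟨v, rfl⟩
          · simp [htop]
          · simp
          · simpa using fun h => hi ⟨v, h⟩
        · obtain ⟨x, hx⟩ := hne
          rcases gadget_cases x with rfl | ⟨v, rfl⟩ | ⟨v, rfl⟩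
          · exact (htop hx).elim
          · exact ⟨v, by simpa using hx⟩
          · exact (hi ⟨v, hx⟩).elim
        · exact Set.subset_univ _
        · intro u hu v hv huv
          rw [Finset.mem_coe, Finset.mem_preimage] at hu hv
          exact gadgetGraph_outer_outer.1 (hG hu hv (by simpa using huv))

/-! ### The layers of the gadget are homology equivalent -/

section Layers

variable [Finite V]

instance : Fintype (WithTop (Layered V)) := Fintype.ofFinite _

/-- Inner vertices are deleted in increasing order. At the turn of `(v, 1)` every remaining inner
neighbour `(u, 1)` has `r v u`, hence is adjacent to `(v, 0)`, which therefore dominates `(v, 1)`.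
-/
theorem homologyEquiv_diff_inner [IsStrictTotalOrder V r] {X : Set (WithTop (Layered V))}
    (htop : ⊤ ∉ X) (hT : outer V '' T ⊆ X) (hX : ∀ v, innerLayer v ∈ X → v ∈ T) :
    HomologyEquiv (gadgetGraph G T r) (X \ innerLayer '' T) X := by
  classical
  let r' : WithTop (Layered V) → WithTop (Layered V) → Prop :=
    fun x y => ∃ u v, x = innerLayer u ∧ y = innerLayer v ∧ r u v
  have : IsStrictOrder _ r' :=
    { irrefl := by
        rintro _ ⟨u, v, rfl, h, huv⟩
        rw [inner_inj] at h
        exact irrefl_of r u (h ▸ huv)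
      trans := by
        rintro _ _ _ ⟨u, v, rfl, rfl, huv⟩ ⟨v', w, h, rfl, hvw⟩
        rw [inner_inj] at h
        exact ⟨u, w, rfl, rfl, trans_of r huv (h ▸ hvw)⟩ }
  have hfin : (innerLayer '' T).Finite := Set.toFinite _
  have hR : (hfin.toFinset : Set (WithTop (Layered V))) = innerLayer '' T := hfin.coe_toFinset
  rw [← hR]
  refine homologyEquiv_of_dismantling r' swapLayer hfin.toFinset (fun x hx => ?_)
    fun x hx y hyX hxy hr hne => ?_
  · obtain ⟨v, hv, rfl⟩ := hfin.mem_toFinset.1 hx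
    rw [swapLayer_inner]
    refine ⟨hT ⟨v, hv, rfl⟩, ?_, (gadgetGraph_outer_inner.2 ⟨hv, hv, Or.inl rfl⟩).symm⟩
    simp
  · obtain ⟨v, hv, rfl⟩ := hfin.mem_toFinset.1 hx
    rw [swapLayer_inner] at hne ⊢
    rcases gadget_cases y with rfl | ⟨u, rfl⟩ | ⟨u, rfl⟩
    · exact (htop hyX).elim
    · have h := (gadgetGraph_outer_inner.1 hxy.symm).2.2.resolve_left fun h => hne (by rw [h])
      exact gadgetGraph_outer_outer.2 h.1.symm
    · have huT := hX u hyX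
      have hadj := gadgetGraph_inner_inner.1 hxy
      refine gadgetGraph_outer_inner.2 ⟨hv, huT, Or.inr ⟨hadj, ?_⟩⟩
      have hn : ¬ r u v := fun h => hr (hfin.mem_toFinset.2 ⟨u, huT, rfl⟩) ⟨u, v, rfl, rfl, h⟩
      rcases trichotomous_of r u v with h | h | h
      · exact (hn h).elim
      · exact (hadj.ne h.symm).elim
      · exact h

/-- The mirror image: outer vertices go in decreasing order, each dominated by its inner copy. -/
theorem homologyEquiv_inner [IsStrictTotalOrder V r] :
    HomologyEquiv (gadgetGraph G T r) (innerLayer '' T) (outer V '' T ∪ innerLayer '' T) := by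
  classical
  let r' : WithTop (Layered V) → WithTop (Layered V) → Prop :=
    fun x y => ∃ u v, x = outer V u ∧ y = outer V v ∧ r v u
  have : IsStrictOrder _ r' :=
    { irrefl := by
        rintro _ ⟨u, v, rfl, h, huv⟩
        rw [(outer V).injective.eq_iff] at h
        exact irrefl_of r u (h ▸ huv)
      trans := by
        rintro _ _ _ ⟨u, v, rfl, rfl, huv⟩ ⟨v', w, h, rfl, hvw⟩
        rw [(outer V).injective.eq_iff] at h
        exact ⟨u, w, rfl, rfl, trans_of r (h ▸ hvw) huv⟩ }
  have hfin : (outer V '' T).Finite := Set.toFinite _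
  have hR : (hfin.toFinset : Set (WithTop (Layered V))) = outer V '' T := hfin.coe_toFinset
  have hdiff : (outer V '' T ∪ innerLayer '' T) \ outer V '' T = innerLayer '' T := by
    rw [Set.union_sdiff_left, sdiff_eq_left, Set.disjoint_left]
    rintro _ ⟨u, -, rfl⟩ ⟨v, -, h⟩
    exact outer_ne_inner _ _ h
  suffices h : HomologyEquiv (gadgetGraph G T r)
      ((outer V '' T ∪ innerLayer '' T) \ (hfin.toFinset : Set _)) (outer V '' T ∪ innerLayer '' T) by
    rwa [hR, hdiff] at h
  refine homologyEquiv_of_dismantling r' swapLayer hfin.toFinset (fun x hx => ?_)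
    fun x hx y hyX hxy hr hne => ?_
  · obtain ⟨v, hv, rfl⟩ := hfin.mem_toFinset.1 hx
    rw [swapLayer_outer]
    refine ⟨Or.inr ⟨v, hv, rfl⟩, ?_, gadgetGraph_outer_inner.2 ⟨hv, hv, Or.inl rfl⟩⟩
    simp
  · obtain ⟨v, hv, rfl⟩ := hfin.mem_toFinset.1 hx
    rw [swapLayer_outer] at hne ⊢
    rcases hyX with ⟨u, huT, rfl⟩ | ⟨u, huT, rfl⟩
    · have hadj := gadgetGraph_outer_outer.1 hxy
      refine (gadgetGraph_outer_inner.2 ⟨huT, hv, Or.inr ⟨hadj.symm, ?_⟩⟩).symm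
      have hn : ¬ r v u := fun h => hr (hfin.mem_toFinset.2 ⟨u, huT, rfl⟩) ⟨u, v, rfl, rfl, h⟩
      rcases trichotomous_of r u v with h | h | h
      · exact h
      · exact (hadj.ne h.symm).elim
      · exact (hn h).elim
    · have h := (gadgetGraph_outer_inner.1 hxy).2.2.resolve_left fun h => hne (by rw [h])
      exact gadgetGraph_inner_inner.2 h.1

end Layers

end GadgetGraph

/-! ### Chains of a complex as chains of the full simplex -/

section Transfer

variable {V W : Type*}

/-- The chains supported on the simplices of `K`. -/
def faceChains (K : PreAbstractSimplicialComplex V) : Submodule ℂ (Finset V → ℂ) where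
  carrier := {c | ∀ s : Finset V, c s ≠ 0 → s = ∅ ∨ s ∈ K.faces}
  zero_mem' := fun s hs => absurd rfl hs
  add_mem' := fun {a b} ha hb s hs => by
    by_cases h : a s = 0
    · exact hb s fun h' => hs (by simp [h, h'])
    · exact ha s h
  smul_mem' := fun a c hc s hs => hc s fun h => hs (by simp [h])

theorem faceChains_cliqueComplexOn (S : Set V) (G : SimpleGraph V) :
    faceChains (cliqueComplexOn S G) = cliqueChains G S := by
  ext c
  refine forall₂_congr fun s _ => ?_
  rcases s.eq_empty_or_nonempty with rfl | h
  · simp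
  · constructor
    · rintro (rfl | h')
      · simp at h
      · exact h'.2
    · exact fun h' => Or.inr ⟨h, h'⟩

theorem erase_empty_or_mem_faces [DecidableEq V] {K : PreAbstractSimplicialComplex V} {s : Finset V}
    (hs : s = ∅ ∨ s ∈ K.faces) (v : V) : s.erase v = ∅ ∨ s.erase v ∈ K.faces := by
  rcases (s.erase v).eq_empty_or_nonempty with h | h
  · exact Or.inl h
  · rcases hs with rfl | hs
    · simp at h
    · exact Or.inr ((K.isRelLowerSet_faces hs).2 (Finset.erase_subset _ _) h)

open Classical in
/-- Extension of a chain by zero. -/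
def extend (K : PreAbstractSimplicialComplex V) (p : ℕ) : Chain K p →ₗ[ℂ] (Finset V → ℂ) where
  toFun c s := if h : (s = ∅ ∨ s ∈ K.faces) ∧ s.card = p then c ⟨s, h⟩ else 0
  map_add' c c' := by ext s; simp only [Pi.add_apply]; split_ifs <;> simp
  map_smul' a c := by ext s; simp only [Pi.smul_apply, RingHom.id_apply]; split_ifs <;> simp

/-- The part of a chain on the simplices of `K` with `p` vertices. -/
def restrict (K : PreAbstractSimplicialComplex V) (p : ℕ) : (Finset V → ℂ) →ₗ[ℂ] Chain K p where
  toFun c σ := c σ.1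
  map_add' _ _ := rfl
  map_smul' _ _ := rfl

variable {K : PreAbstractSimplicialComplex V} {L : PreAbstractSimplicialComplex W} {p : ℕ}

theorem restrict_extend (c : Chain K p) : restrict K p (extend K p c) = c := by
  ext σ
  exact dif_pos σ.2

theorem extend_injective : Function.Injective (extend K p) :=
  Function.LeftInverse.injective restrict_extend

theorem of_extend_ne_zero {c : Chain K p} {s : Finset V} (h : extend K p c s ≠ 0) :
    (s = ∅ ∨ s ∈ K.faces) ∧ #s = p := by
  by_contra h'
  exact h (dif_neg h')

theorem extend_mem (c : Chain K p) : extend K p c ∈ faceChains K :=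
  fun _ hs => (of_extend_ne_zero hs).1

theorem extend_restrict {f : Finset V → ℂ} (hf : f ∈ faceChains K) (hp : ∀ s, f s ≠ 0 → #s = p) :
    extend K p (restrict K p f) = f := by
  ext s
  by_cases h : (s = ∅ ∨ s ∈ K.faces) ∧ #s = p
  · exact dif_pos h
  · refine (dif_neg h).trans ?_
    by_contra h'
    exact h ⟨hf s (Ne.symm h'), hp s (Ne.symm h')⟩

theorem restrict_eq_zero {f : Finset V → ℂ} {q : ℕ} (hf : ∀ s, f s ≠ 0 → #s = q) (hpq : p ≠ q) :
    restrict K p f = 0 := by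
  ext σ
  by_contra h
  exact hpq (σ.2.2 ▸ hf _ h)

variable [LinearOrder V] [LinearOrder W]

open Classical in
/-- The map on chains of the full simplices induced by an embedding of vertices. -/
def embedChain (e : V ↪o W) : (Finset V → ℂ) →ₗ[ℂ] (Finset W → ℂ) where
  toFun c t := if (t : Set W) ⊆ Set.range e then c (t.preimage e e.injective.injOn) else 0
  map_add' c c' := by ext s; simp only [Pi.add_apply]; split_ifs <;> simp
  map_smul' a c := by ext s; simp only [Pi.smul_apply, RingHom.id_apply]; split_ifs <;> simp

variable (e : V ↪o W)

theorem embedChain_map (c : Finset V → ℂ) (s : Finset V) :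
    embedChain e c (s.map e.toEmbedding) = c s := by
  refine (if_pos ?_).trans (congrArg c ?_)
  · rw [Finset.coe_map]
    exact Set.image_subset_range _ _
  · ext v; simp

theorem eq_map_of_subset_range {t : Finset W} (h : (t : Set W) ⊆ Set.range e) :
    ∃ s : Finset V, t = s.map e.toEmbedding := by
  refine ⟨t.preimage e e.injective.injOn, ?_⟩
  ext w
  simp only [Finset.mem_map, Finset.mem_preimage]
  constructor
  · intro hw
    obtain ⟨v, rfl⟩ := h hw
    exact ⟨v, hw, rfl⟩
  · rintro ⟨v, hv, rfl⟩
    exact hv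

theorem eq_map_of_embedChain_ne_zero {c : Finset V → ℂ} {t : Finset W} (h : embedChain e c t ≠ 0) :
    ∃ s : Finset V, t = s.map e.toEmbedding ∧ c s ≠ 0 := by
  obtain ⟨s, rfl⟩ := eq_map_of_subset_range e (t := t) (by by_contra h'; exact h (if_neg h'))
  exact ⟨s, rfl, embedChain_map e c s ▸ h⟩

theorem embedChain_injective : Function.Injective (embedChain e) := fun c c' h => by
  ext s
  rw [← embedChain_map e c, h, embedChain_map]

theorem vertexSign_map (s : Finset V) (v : V) :
    vertexSign (s.map e.toEmbedding) (e v) = vertexSign s v := by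
  unfold vertexSign
  rw [Finset.filter_map, Finset.card_map]
  congr 2
  ext u
  simp

theorem restrict_embedChain [Finite V] {f : Finset V → ℂ} (hf : f ∈ faceChains K) (p : ℕ) :
    restrict L p (embedChain e f) = push K L e p (restrict K p f) := by
  ext τ
  change embedChain e f τ.1 = ∑ σ : Simplex K p,
    (if τ.1 = σ.1.map e.toEmbedding then 1 else 0) * f σ.1
  simp only [ite_mul, one_mul, zero_mul]
  by_cases hτ : ∃ σ : Simplex K p, τ.1 = σ.1.map e.toEmbedding
  · obtain ⟨σ, hσ⟩ := hτ
    rw [Finset.sum_eq_single σ, if_pos hσ, hσ, embedChain_map]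
    · intro σ' _ hne
      refine if_neg fun h' => hne (Subtype.ext ?_)
      exact Finset.map_injective e.toEmbedding (h'.symm.trans hσ)
    · simp
  · rw [Finset.sum_eq_zero fun σ _ => if_neg fun h' => hτ ⟨σ, h'⟩]
    by_contra h'
    obtain ⟨s, hs, hs'⟩ := eq_map_of_embedChain_ne_zero e h'
    refine hτ ⟨⟨s, hf s hs', ?_⟩, hs⟩
    rw [← Finset.card_map e.toEmbedding, ← hs]
    exact τ.2.2

theorem extend_push [Finite V] (h : ∀ s ∈ K.faces, s.map e.toEmbedding ∈ L.faces) (c : Chain K p) :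
    extend L p (push K L e p c) = embedChain e (extend K p c) := by
  conv_lhs => rw [← restrict_extend c, ← restrict_embedChain e (extend_mem c)]
  refine extend_restrict (fun t ht => ?_) (fun t ht => ?_) <;>
  obtain ⟨s, rfl, hs⟩ := eq_map_of_embedChain_ne_zero e ht <;>
  obtain ⟨h1, h2⟩ := of_extend_ne_zero hs
  · exact h1.imp (fun h0 => by rw [h0, Finset.map_empty]) (h _)
  · rw [Finset.card_map, h2]

variable {G : SimpleGraph V} {H : SimpleGraph W}

theorem embedChain_mem_cliqueChains (he : ∀ u v, H.Adj (e u) (e v) ↔ G.Adj u v) {S : Set V}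
    {c : Finset V → ℂ} (hc : c ∈ cliqueChains G S) : embedChain e c ∈ cliqueChains H (e '' S) := by
  intro t ht
  obtain ⟨s, rfl, hs⟩ := eq_map_of_embedChain_ne_zero e ht
  obtain ⟨h1, h2⟩ := hc s hs
  rw [Finset.coe_map]
  refine ⟨Set.image_mono h1, ?_⟩
  rintro _ ⟨u, hu, rfl⟩ _ ⟨v, hv, rfl⟩ huv
  exact (he u v).2 (h2 hu hv fun h => huv (by rw [h]))

theorem exists_embedChain_eq (he : ∀ u v, H.Adj (e u) (e v) ↔ G.Adj u v) {S : Set V}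
    {c : Finset W → ℂ} (hc : c ∈ cliqueChains H (e '' S)) :
    ∃ c' ∈ cliqueChains G S, embedChain e c' = c := by
  refine ⟨fun s => c (s.map e.toEmbedding), fun s hs => ?_, ?_⟩
  · obtain ⟨h1, h2⟩ := hc _ hs
    rw [Finset.coe_map] at h1 h2
    refine ⟨(Set.image_subset_image_iff e.injective).1 h1, fun u hu v hv huv => ?_⟩
    exact (he u v).1 (h2 ⟨u, hu, rfl⟩ ⟨v, hv, rfl⟩ (by simpa using huv))
  · ext t
    by_cases ht : (t : Set W) ⊆ Set.range e
    · obtain ⟨s, rfl⟩ := eq_map_of_subset_range e ht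
      rw [embedChain_map]
    · refine (if_neg ht).trans ?_
      by_contra h
      exact ht ((hc t (Ne.symm h)).1.trans (Set.image_subset_range _ _))

/-! ### Boundaries, cycles and homology under extension by zero -/

variable [Fintype V]

/-- The only simplex that yields `τ` on losing `v` is `insert v τ`; if it is not a face, `f`
vanishes there. -/
theorem restrict_bdW (w : V → ℝ) {f : Finset V → ℂ} (hf : f ∈ faceChains K) (p : ℕ) :
    restrict K p (bdW (fun v => (w v : ℂ)) f) =
      (boundaryMatrix K w p).mulVecLin (restrict K (p + 1) f) := by
  ext τ
  change bdW (fun v => (w v : ℂ)) f τ.1 = ∑ σ, boundaryMatrix K w p τ σ * f σ.1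
  rw [bdW_apply, Finset.sum_apply]
  have h1 (σ : Simplex K (p + 1)) : boundaryMatrix K w p τ σ * f σ.1 =
      ∑ v, if v ∈ σ.1 ∧ τ.1 = σ.1.erase v then vertexSign σ.1 v * (w v : ℂ) * f σ.1 else 0 := by
    rw [boundaryMatrix, Matrix.of_apply, Finset.sum_mul]
    rw [← Finset.sum_filter_add_sum_filter_not Finset.univ (· ∈ σ.1)]
    rw [Finset.sum_eq_zero (s := Finset.filter (· ∉ σ.1) _), add_zero]
    · refine Finset.sum_congr (by ext; simp) fun v hv => ?_
      simp [(Finset.mem_filter.1 hv).2, vertexSign, ite_mul]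
    · intro v hv
      simp [(Finset.mem_filter.1 hv).2]
  simp only [h1]
  rw [Finset.sum_comm]
  refine Finset.sum_congr rfl fun v _ => ?_
  rw [Pi.smul_apply, smul_eq_mul, ann_apply]
  split_ifs with hv
  · rw [mul_zero, Finset.sum_eq_zero]
    intro σ _
    refine if_neg fun h => ?_
    rw [h.2] at hv
    simp at hv
  by_cases hface : (insert v τ.1 = ∅ ∨ insert v τ.1 ∈ K.faces) ∧ #(insert v τ.1) = p + 1
  · rw [Finset.sum_eq_single ⟨_, hface⟩]
    · rw [if_pos (by simp [hv]), vertexSign_insert_self]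
      ring
    · intro σ _ hσ
      refine if_neg fun h => hσ (Subtype.ext ?_)
      exact (Finset.insert_erase h.1).symm.trans (congrArg (insert v) h.2).symm
    · simp
  · have hf0 : f (insert v τ.1) = 0 := by
      by_contra h
      exact hface ⟨hf _ h, by rw [Finset.card_insert_of_notMem hv, τ.2.2]⟩
    rw [hf0, mul_zero, mul_zero, Finset.sum_eq_zero]
    intro σ _
    refine if_neg fun h => hface ?_
    rw [h.2, Finset.insert_erase h.1]
    exact σ.2

theorem restrict_bd {f : Finset V → ℂ} (hf : f ∈ faceChains K) (p : ℕ) :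
    restrict K p (bd f) = boundary K p (restrict K (p + 1) f) := by
  rw [boundary, ← restrict_bdW _ hf]
  simp

theorem bdW_extend_mem (w : V → ℂ) (c : Chain K (p + 1)) :
    bdW w (extend K (p + 1) c) ∈ faceChains K ∧
      ∀ s, bdW w (extend K (p + 1) c) s ≠ 0 → #s = p := by
  have key (s) (hs : bdW w (extend K (p + 1) c) s ≠ 0) : (s = ∅ ∨ s ∈ K.faces) ∧ #s = p := by
    rw [bdW_apply, Finset.sum_apply] at hs
    obtain ⟨v, -, hv⟩ := Finset.exists_ne_zero_of_sum_ne_zero hs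
    rw [Pi.smul_apply, ann_apply] at hv
    split_ifs at hv with hvs
    · simp at hv
    · obtain ⟨h1, h2⟩ := of_extend_ne_zero
        (right_ne_zero_of_mul (right_ne_zero_of_mul (a := w v) hv))
      have := erase_empty_or_mem_faces h1 v
      rw [Finset.erase_insert hvs] at this
      rw [Finset.card_insert_of_notMem hvs] at h2
      exact ⟨this, by omega⟩
  exact ⟨fun s hs => (key s hs).1, fun s hs => (key s hs).2⟩

theorem extend_boundaryMatrix_mulVec (w : V → ℝ) (c : Chain K (p + 1)) :
    extend K p ((boundaryMatrix K w p).mulVecLin c) =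
      bdW (fun v => (w v : ℂ)) (extend K (p + 1) c) := by
  conv_lhs => rw [← restrict_extend c, ← restrict_bdW w (extend_mem c)]
  exact extend_restrict (bdW_extend_mem _ c).1 (bdW_extend_mem _ c).2

theorem extend_boundary (c : Chain K (p + 1)) :
    extend K p (boundary K p c) = bd (extend K (p + 1) c) := by
  rw [boundary, extend_boundaryMatrix_mulVec]
  simp

theorem boundaryMatrix_mul_boundaryMatrix (w : V → ℝ) (p : ℕ) :
    boundaryMatrix K w p * boundaryMatrix K w (p + 1) = 0 := by
  apply Matrix.ext_of_mulVec_single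
  intro σ
  rw [← Matrix.mulVec_mulVec, Matrix.zero_mulVec]
  apply extend_injective
  have h1 := extend_boundaryMatrix_mulVec (K := K) w
    ((boundaryMatrix K w (p + 1)).mulVecLin (Pi.single σ 1))
  rw [extend_boundaryMatrix_mulVec w (Pi.single σ 1), bdW_bdW] at h1
  rw [map_zero]
  exact h1

theorem mem_cycles_iff {c : Chain K p} : c ∈ cycles K p ↔ bd (extend K p c) = 0 := by
  cases p with
  | zero =>
    -- The boundary of the full simplex kills the empty simplex, in accordance with the convention
    -- for `cycles K 0`.
    refine iff_of_true trivial ?_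
    ext s
    rw [bdW_apply, Finset.sum_apply]
    refine Finset.sum_eq_zero fun v _ => ?_
    rw [one_smul, ann_apply]
    split_ifs
    · rfl
    · by_contra h
      simpa using (of_extend_ne_zero (right_ne_zero_of_mul h)).2
  | succ p =>
    rw [← extend_boundary, map_eq_zero_iff _ extend_injective]
    rfl

/-- `f` may have components in all degrees; only the one with `p + 1` vertices matters. This lets
the ungraded arguments be read degree by degree. -/
theorem restrict_bd_mem_boundaries {f : Finset V → ℂ} (hf : f ∈ faceChains K) :
    restrict K p (bd f) ∈ boundaries K p :=
  ⟨_, (restrict_bd hf p).symm⟩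

theorem exists_of_mem_boundaries {c : Chain K p} (hc : c ∈ boundaries K p) :
    ∃ f ∈ faceChains K, extend K p c = bd f := by
  obtain ⟨b, rfl⟩ := hc
  exact ⟨_, extend_mem b, extend_boundary b⟩

theorem restrict_mem_cycles {f : Finset V → ℂ} (hf : f ∈ faceChains K) (hf0 : bd f = 0) :
    restrict K p f ∈ cycles K p := by
  cases p with
  | zero => trivial
  | succ p =>
    change boundary K p _ = 0
    rw [← restrict_bd hf, hf0, map_zero]

theorem homologyClass_eq_zero_iff {c : Chain K p} {hc : c ∈ cycles K p} :
    homologyClass K c hc = 0 ↔ c ∈ boundaries K p := by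
  rw [homologyClass, Submodule.Quotient.mk_eq_zero]
  rfl

theorem homologyClass_surjective (x : Homology K p) :
    ∃ c, ∃ hc : c ∈ cycles K p, homologyClass K c hc = x := by
  obtain ⟨⟨c, hc⟩, rfl⟩ := Submodule.Quotient.mk_surjective _ x
  exact ⟨c, hc, rfl⟩

/-- The embedding preserves the order, hence the signs, and vertices outside its range contribute
nothing. -/
theorem bd_embedChain [Fintype W] (c : Finset V → ℂ) : bd (embedChain e c) = embedChain e (bd c) := by
  ext t
  rw [bdW_apply, Finset.sum_apply]
  by_cases ht : (t : Set W) ⊆ Set.range e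
  · obtain ⟨s, rfl⟩ := eq_map_of_subset_range e ht
    rw [embedChain_map, bdW_apply, Finset.sum_apply]
    rw [← Finset.sum_subset (Finset.subset_univ (Finset.univ.map e.toEmbedding)), Finset.sum_map]
    · refine Finset.sum_congr rfl fun v _ => ?_
      simp only [one_smul, ann_apply, RelEmbedding.coe_toEmbedding, vertexSign_map]
      have h1 : e v ∈ s.map e.toEmbedding ↔ v ∈ s := by simp
      have h2 : insert (e v) (s.map e.toEmbedding) = (insert v s).map e.toEmbedding := by
        rw [Finset.map_insert]; rfl
      simp only [h1, h2, embedChain_map]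
    · intro w _ hw
      rw [one_smul, ann_apply]
      split_ifs
      · rfl
      · by_contra h
        obtain ⟨s', hs', -⟩ := eq_map_of_embedChain_ne_zero e (right_ne_zero_of_mul h)
        have : w ∈ s'.map e.toEmbedding := hs' ▸ Finset.mem_insert_self _ _
        exact hw (Finset.map_subset_map.2 (Finset.subset_univ s') this)
  · have h0 : embedChain e (bd c) t = 0 := if_neg ht
    rw [h0]
    refine Finset.sum_eq_zero fun w _ => ?_
    rw [one_smul, ann_apply]
    split_ifs
    · rfl
    · by_contra h
      obtain ⟨s', hs', -⟩ := eq_map_of_embedChain_ne_zero e (right_ne_zero_of_mul h)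
      refine ht ?_
      have : t ⊆ s'.map e.toEmbedding := hs' ▸ Finset.subset_insert _ _
      refine (Finset.coe_subset.2 this).trans ?_
      rw [Finset.coe_map]
      exact Set.image_subset_range _ _

end Transfer

/-! ### Laplacians, the Witten index and the Euler characteristic -/

section Witten

open Matrix ComplexOrder in
-- Hodge theory: applying `A` kills the second term and leaves `A Aᴴ A x = 0`, so `A x = 0` by
-- positivity, and then `Bᴴ x = 0`.
theorem ker_conjTranspose_mul_self_add {l n k : Type*} [Fintype l] [Fintype n] [Fintype k]
    {A : Matrix l n ℂ} {B : Matrix n k ℂ} (h : A * B = 0) :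
    LinearMap.ker (Aᴴ * A + B * Bᴴ).mulVecLin =
      LinearMap.ker A.mulVecLin ⊓ LinearMap.ker Bᴴ.mulVecLin := by
  ext x
  simp only [Submodule.mem_inf, LinearMap.mem_ker, mulVecLin_apply]
  constructor
  · intro hx
    have hA : A *ᵥ x = 0 := by
      have h1 : A *ᵥ ((Aᴴ * A + B * Bᴴ) *ᵥ x) = 0 := by rw [hx, mulVec_zero]
      rw [mulVec_mulVec, Matrix.mul_add, ← Matrix.mul_assoc A B, h, Matrix.zero_mul, add_zero,
        ← Matrix.mul_assoc, ← mulVec_mulVec, self_mul_conjTranspose_mulVec_eq_zero, mulVec_mulVec,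
        conjTranspose_mul_self_mulVec_eq_zero] at h1
      exact h1
    refine ⟨hA, ?_⟩
    rwa [add_mulVec, ← mulVec_mulVec, hA, mulVec_zero, zero_add,
      self_mul_conjTranspose_mulVec_eq_zero] at hx
  · rintro ⟨h1, h2⟩
    rw [add_mulVec, ← mulVec_mulVec, ← mulVec_mulVec, h1, h2, mulVec_zero, mulVec_zero, add_zero]

open Matrix ComplexOrder in
-- Restricting `Bᴴ` to `ker A` loses no rank, because `ker A` contains the range of `B` and `Bᴴ B`
-- has the rank of `B`.
theorem finrank_ker_conjTranspose_mul_self_add {l n k : Type*} [Fintype l] [Fintype n] [Fintype k]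
    {A : Matrix l n ℂ} {B : Matrix n k ℂ} (h : A * B = 0) :
    Module.finrank ℂ (LinearMap.ker (Aᴴ * A + B * Bᴴ).mulVecLin) + A.rank + B.rank =
      Fintype.card n := by
  classical
  set g := Bᴴ.mulVecLin.domRestrict (LinearMap.ker A.mulVecLin) with hg
  have hker : Module.finrank ℂ (LinearMap.ker g) =
      Module.finrank ℂ (LinearMap.ker (Aᴴ * A + B * Bᴴ).mulVecLin) := by
    rw [ker_conjTranspose_mul_self_add h, hg, LinearMap.ker_domRestrict,
      ← Submodule.finrank_map_subtype_eq, Submodule.map_comap_subtype]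
  have hrange : Module.finrank ℂ (LinearMap.range g) = B.rank := by
    apply le_antisymm
    · rw [← rank_conjTranspose B]
      refine Submodule.finrank_mono ?_
      rintro _ ⟨x, rfl⟩
      exact ⟨x.1, rfl⟩
    · rw [← rank_conjTranspose_mul_self B]
      refine Submodule.finrank_mono ?_
      rintro _ ⟨x, rfl⟩
      refine ⟨⟨B *ᵥ x, ?_⟩, ?_⟩
      · simp [LinearMap.mem_ker, mulVec_mulVec, h]
      · simp [hg, mulVec_mulVec]
  have h1 := LinearMap.finrank_range_add_finrank_ker g
  have h2 := LinearMap.finrank_range_add_finrank_ker A.mulVecLin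
  rw [Module.finrank_fintype_fun_eq_card] at h2
  rw [hker, hrange] at h1
  unfold Matrix.rank at *
  omega

theorem sum_neg_one_pow_telescope {n h ρ : ℕ → ℤ} (h0 : h 0 + ρ 0 = n 0)
    (hs : ∀ p, h (p + 1) + ρ p + ρ (p + 1) = n (p + 1)) (N : ℕ) :
    ∑ p ∈ range (N + 1), (-1) ^ p * h p =
      ∑ p ∈ range (N + 1), (-1) ^ p * n p - (-1) ^ N * ρ N := by
  induction N with
  | zero => simp [← h0]
  | succ N ih =>
    rw [Finset.sum_range_succ, ih, Finset.sum_range_succ _ (N + 1), ← hs N]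
    ring

/-- Used twice: with `h` counting harmonic chains for the Witten index, and with `h` the Betti
numbers for Euler–Poincaré. -/
theorem sum_finrank_eq_neg_reducedEulerChar {V : Type*} [Finite V]
    (K : PreAbstractSimplicialComplex V) {h ρ : ℕ → ℕ} (h0 : h 0 + ρ 0 = Nat.card (Simplex K 0))
    (hs : ∀ p, h (p + 1) + ρ p + ρ (p + 1) = Nat.card (Simplex K (p + 1)))
    (hN : ρ (Nat.card V) = 0) :
    ∑ p ∈ range (Nat.card V + 1), (-1) ^ p * (h p : ℤ) = -reducedEulerChar K := by
  rw [sum_neg_one_pow_telescope (h := fun p => (h p : ℤ)) (n := fun p => Nat.card (Simplex K p))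
    (ρ := fun p => (ρ p : ℤ)) (by exact_mod_cast h0) (fun p => by exact_mod_cast hs p), hN,
    reducedEulerChar, ← Finset.sum_neg_distrib]
  simp [pow_succ]

variable {V : Type*} [LinearOrder V] [Fintype V] (K : PreAbstractSimplicialComplex V)

theorem rank_boundaryMatrix_card (w : V → ℝ) : (boundaryMatrix K w (Nat.card V)).rank = 0 := by
  have : IsEmpty (Simplex K (Nat.card V + 1)) := ⟨fun σ => by
    have h : #σ.1 ≤ Nat.card V :=
      (Finset.card_le_univ σ.1).trans_eq Nat.card_eq_fintype_card.symm
    have h' : #σ.1 = Nat.card V + 1 := σ.2.2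
    omega⟩
  have h := Matrix.rank_le_card_width (boundaryMatrix K w (Nat.card V))
  rw [Fintype.card_eq_zero] at h
  exact Nat.le_zero.1 h

/-- The Witten index does not depend on the weights. -/
theorem wittenIndex_eq (w : V → ℝ) : wittenIndex K w = -reducedEulerChar K := by
  -- The ranks may depend on `w`, but they cancel in the alternating sum.
  refine sum_finrank_eq_neg_reducedEulerChar K (ρ := fun p => (boundaryMatrix K w p).rank) ?_
    (fun p => ?_) (rank_boundaryMatrix_card K w)
  -- An empty zero matrix stands for the missing boundary out of degree zero.
  · have h : laplacian K w 0 =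
        (0 : Matrix (Fin 0) _ ℂ).conjTranspose * (0 : Matrix (Fin 0) (Simplex K 0) ℂ) +
        boundaryMatrix K w 0 * (boundaryMatrix K w 0).conjTranspose := by simp [laplacian]
    rw [Nat.card_eq_fintype_card, ← finrank_ker_conjTranspose_mul_self_add
      (A := (0 : Matrix (Fin 0) _ ℂ)) (B := boundaryMatrix K w 0) (by simp), h, Matrix.rank_zero,
      add_zero]
  · rw [Nat.card_eq_fintype_card, ← finrank_ker_conjTranspose_mul_self_add
      (boundaryMatrix_mul_boundaryMatrix w p)]
    rfl

theorem boundaries_le_cycles (p : ℕ) : boundaries K p ≤ cycles K p := by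
  intro c hc
  obtain ⟨f, -, hf⟩ := exists_of_mem_boundaries hc
  rw [mem_cycles_iff, hf, bdW_bdW]

theorem finrank_homology_add (p : ℕ) :
    Module.finrank ℂ (Homology K p) + (boundaryMatrix K (fun _ => 1) p).rank =
      Module.finrank ℂ (cycles K p) := by
  have h1 := Submodule.finrank_quotient_add_finrank ((boundaries K p).submoduleOf (cycles K p))
  rw [(Submodule.submoduleOfEquivOfLe (boundaries_le_cycles K p)).finrank_eq] at h1
  exact h1

/-- The Euler–Poincaré formula. -/
theorem sum_finrank_homology : ∑ p ∈ range (Nat.card V + 1),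
    (-1) ^ p * (Module.finrank ℂ (Homology K p) : ℤ) = -reducedEulerChar K := by
  refine sum_finrank_eq_neg_reducedEulerChar K
    (h := fun p => Module.finrank ℂ (Homology K p))
    (ρ := fun p => (boundaryMatrix K (fun _ => 1) p).rank) ?_ (fun p => ?_)
    (rank_boundaryMatrix_card K _)
  · rw [finrank_homology_add, Nat.card_eq_fintype_card]
    change Module.finrank ℂ (⊤ : Submodule ℂ (Chain K 0)) = _
    rw [finrank_top, Module.finrank_fintype_fun_eq_card]
  · have h1 := LinearMap.finrank_range_add_finrank_ker (boundary K p)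
    rw [Module.finrank_fintype_fun_eq_card, ← Nat.card_eq_fintype_card] at h1
    rw [add_right_comm, finrank_homology_add, ← h1, add_comm]
    rfl

end Witten

/-! ### The gadget for a computational basis state -/

section Gadget

variable {m : ℕ}

theorem qubitSet_univ (m : ℕ) :
    qubitSet (fun _ => Set.univ) (Finset.univ : Finset (Fin m)) = Set.univ := by
  ext x
  obtain ⟨b, i, h⟩ := exists_loopVertex_eq (ofLex x).2
  exact iff_of_true ⟨Finset.mem_univ _, b, trivial, i, h⟩ trivial

/-- The vertices on the loops of the bits `z i`. -/
def basisSet (z : Fin m → Bool) : Set (QubitVertex m) :=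
  {x | (ofLex x).2 ∈ Set.range (loopVertex (z (ofLex x).1))}

theorem qubitSet_singleton (z : Fin m → Bool) :
    qubitSet (fun i => {z i}) Finset.univ = basisSet z := by
  ext x; simp [qubitSet, basisSet]

/-- The chain of the computational basis state as a chain of the full simplex. -/
abbrev basisChain (y : Fin m → Bool) : Finset (QubitVertex m) → ℂ := partialCycle y Finset.univ

theorem basisChain_mem_basisSet (z : Fin m → Bool) :
    basisChain z ∈ cliqueChains (qubitGraph m) (basisSet z) :=
  qubitSet_singleton z ▸ partialCycle_mem (B := fun i => {z i}) (fun _ => rfl) _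

theorem basisChain_mem (y : Fin m → Bool) :
    basisChain y ∈ cliqueChains (qubitGraph m) Set.univ :=
  cliqueChains_mono (Set.subset_univ _) (basisChain_mem_basisSet y)

theorem exists_eq_sum_basisChain {c : Finset (QubitVertex m) → ℂ}
    (hc : c ∈ cliqueChains (qubitGraph m) Set.univ) (hc0 : bd c = 0) :
    ∃ a : (Fin m → Bool) → ℂ, ∃ b ∈ cliqueChains (qubitGraph m) Set.univ,
      c = ∑ y, a y • basisChain y + bd b := by
  have h := mem_loopsAndBoundaries (B := fun _ => Set.univ) (fun _ => ⟨true, trivial⟩) Finset.univ c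
    (qubitSet_univ m ▸ hc) hc0
  obtain ⟨d, hd, _, ⟨b, hb, rfl⟩, rfl⟩ := Submodule.mem_sup.1 h
  have hset : (partialCycle · Finset.univ) '' {y : Fin m → Bool | ∀ i, y i ∈ Set.univ} =
      Set.range basisChain := by
    ext x; simp [basisChain]
  rw [hset, Submodule.mem_span_range_iff_exists_fun] at hd
  obtain ⟨a, rfl⟩ := hd
  exact ⟨a, b, qubitSet_univ m ▸ hb, rfl⟩

theorem exists_eq_smul_basisChain (z : Fin m → Bool) {c : Finset (QubitVertex m) → ℂ}
    (hc : c ∈ cliqueChains (qubitGraph m) (basisSet z)) (hc0 : bd c = 0) :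
    ∃ a : ℂ, ∃ b ∈ cliqueChains (qubitGraph m) (basisSet z), c = a • basisChain z + bd b := by
  have h := mem_loopsAndBoundaries (B := fun i => {z i}) (fun i => ⟨z i, rfl⟩) Finset.univ c
    (qubitSet_singleton z ▸ hc) hc0
  obtain ⟨d, hd, _, ⟨b, hb, rfl⟩, rfl⟩ := Submodule.mem_sup.1 h
  have hset : (partialCycle · Finset.univ) '' {y : Fin m → Bool | ∀ i, y i ∈ ({z i} : Set Bool)} =
      {basisChain z} := by
    ext x
    simp only [Set.mem_singleton_iff, Set.mem_image, Set.mem_ofPred_eq, ← funext_iff]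
    simp [eq_comm]
  rw [hset, Submodule.mem_span_singleton] at hd
  obtain ⟨a, rfl⟩ := hd
  exact ⟨a, b, qubitSet_singleton z ▸ hb, rfl⟩

variable (z : Fin m → Bool) (r : QubitVertex m → QubitVertex m → Prop)

theorem gadgetComplex_eq : gadgetComplex z r = cliqueComplexOn (gadgetVertices (basisSet z))
    (gadgetGraph (qubitGraph m) (basisSet z) r) :=
  gluedComplex_eq_cliqueComplexOn

/-- The inclusion of the chains of the qubit complex. -/
abbrev outerChain (m : ℕ) := embedChain (outer (QubitVertex m))

theorem coneAttachment [IsStrictTotalOrder (QubitVertex m) r] :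
    ConeAttachment (gadgetGraph (qubitGraph m) (basisSet z) r)
      (outer (QubitVertex m) '' Set.univ) (gadgetVertices (basisSet z))
      (outer (QubitVertex m) '' basisSet z) (innerLayer '' basisSet z)
      (outer (QubitVertex m) '' basisSet z ∪ innerLayer '' basisSet z) ⊤
      (outerChain m (basisChain z)) := by
  have hadj (u v : QubitVertex m) := gadgetGraph_outer_outer (G := qubitGraph m)
    (T := basisSet z) (r := r) (u := u) (v := v)
  have hdisj (X : Set (QubitVertex m)) :
      (outer (QubitVertex m) '' X ∪ innerLayer '' basisSet z) \ innerLayer '' basisSet z =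
        outer (QubitVertex m) '' X := by
    rw [Set.union_sdiff_right, sdiff_eq_left, Set.disjoint_left]
    rintro _ ⟨u, -, rfl⟩ ⟨v, -, h⟩
    exact inner_ne_outer _ _ h
  have hverts : gadgetVertices (basisSet z) \ {⊤} =
      outer (QubitVertex m) '' Set.univ ∪ innerLayer '' basisSet z := by
    rw [Set.image_univ, gadgetVertices, Set.union_sdiff_right, sdiff_eq_left, Set.disjoint_left]
    rintro _ (⟨u, rfl⟩ | ⟨u, -, rfl⟩) <;> simp
  have hequiv (X : Set (QubitVertex m)) (hX : basisSet z ⊆ X) :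
      HomologyEquiv (gadgetGraph (qubitGraph m) (basisSet z) r) (outer (QubitVertex m) '' X)
        (outer (QubitVertex m) '' X ∪ innerLayer '' basisSet z) := by
    have h := homologyEquiv_diff_inner (G := qubitGraph m) (T := basisSet z) (r := r)
      (X := outer (QubitVertex m) '' X ∪ innerLayer '' basisSet z) (by simp)
      ((Set.image_mono hX).trans Set.subset_union_left) (by simp)
    rwa [hdisj] at h
  refine
    { apex_mem := top_mem_gadgetVertices
      outer_subset := hverts ▸ Set.subset_union_left
      subset := hverts ▸ Set.union_subset_union_left _ (Set.image_mono (Set.subset_univ _))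
      subset_outer := Set.image_mono (Set.subset_univ _)
      subset_zero := Set.subset_union_left
      subset_one := Set.subset_union_right
      link := ?_
      equiv := hverts ▸ hequiv _ (Set.subset_univ _)
      equiv_zero := hequiv _ subset_rfl
      equiv_one := homologyEquiv_inner
      cycle_mem := embedChain_mem_cliqueChains _ hadj (basisChain_mem_basisSet z)
      bd_cycle := by rw [bd_embedChain, bd_partialCycle, map_zero]
      spanned := ?_
      indep := ?_ }
  · rintro u (⟨⟨v, rfl⟩ | ⟨v, hv, rfl⟩⟩ | rfl)
    · refine iff_of_false (gadgetGraph_top_outer v) ?_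
      simp
    · exact iff_of_true (gadgetGraph_top_inner v) ⟨v, hv, rfl⟩
    · refine iff_of_false (fun h => h.ne rfl) ?_
      simp
  · intro c hc hc0
    obtain ⟨c, hc', rfl⟩ := exists_embedChain_eq _ hadj hc
    rw [bd_embedChain, map_eq_zero_iff _ (embedChain_injective _)] at hc0
    obtain ⟨a, b, hb, rfl⟩ := exists_eq_smul_basisChain z hc' hc0
    exact ⟨a, _, embedChain_mem_cliqueChains _ hadj hb, by rw [bd_embedChain, map_add, map_smul]⟩
  · intro a b hb h
    obtain ⟨b, hb', rfl⟩ := exists_embedChain_eq _ hadj hb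
    rw [bd_embedChain, ← map_smul] at h
    have h' := embedChain_injective _ h
    have := eq_zero_of_sum_partialCycle_eq_bd (a := fun y => if y = z then a else 0) hb'
      (by simpa using h') z
    simpa using this

/-! ### Homology of the qubit complex and of the glued complex -/

theorem faceChains_qubitComplex :
    faceChains (qubitComplex m) = cliqueChains (qubitGraph m) Set.univ :=
  faceChains_cliqueComplexOn _ _

theorem faceChains_gadgetComplex : faceChains (gadgetComplex z r) =
    cliqueChains (gadgetGraph (qubitGraph m) (basisSet z) r) (gadgetVertices (basisSet z)) := by
  rw [gadgetComplex_eq, faceChains_cliqueComplexOn]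

theorem restrict_basisChain (y : Fin m → Bool) :
    restrict (qubitComplex m) (2 * m) (basisChain y) = basisCycle y := by
  ext σ
  simp [restrict, basisChain, partialCycle, basisCycle]

theorem extend_basisCycle (y : Fin m → Bool) :
    extend (qubitComplex m) (2 * m) (basisCycle y) = basisChain y := by
  rw [← restrict_basisChain]
  exact extend_restrict (faceChains_qubitComplex ▸ basisChain_mem y)
    fun s hs => card_eq_of_partialCycle_ne_zero hs

theorem basisCycle_mem_cycles (y : Fin m → Bool) :
    basisCycle y ∈ cycles (qubitComplex m) (2 * m) := by
  rw [mem_cycles_iff, extend_basisCycle, bd_partialCycle]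

/-- The homology class of a computational basis state. -/
def basisClass (y : Fin m → Bool) : Homology (qubitComplex m) (2 * m) :=
  homologyClass _ (basisCycle y) (basisCycle_mem_cycles y)

theorem homologyClass_eq_iff {p : ℕ} {V : Type*} [LinearOrder V] [Finite V]
    {K : PreAbstractSimplicialComplex V} {c c' : Chain K p} {hc : c ∈ cycles K p}
    {hc' : c' ∈ cycles K p} :
    homologyClass K c hc = homologyClass K c' hc' ↔ c - c' ∈ boundaries K p := by
  rw [homologyClass, homologyClass, Submodule.Quotient.eq]
  rfl

theorem homologyClass_sum {p : ℕ} {V : Type*} [LinearOrder V] [Finite V]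
    {K : PreAbstractSimplicialComplex V} {ι : Type*} [Fintype ι] (a : ι → ℂ) (c : ι → Chain K p)
    (hc : ∀ i, c i ∈ cycles K p) (h : ∑ i, a i • c i ∈ cycles K p) :
    homologyClass K (∑ i, a i • c i) h = ∑ i, a i • homologyClass K (c i) (hc i) := by
  have e : (⟨∑ i, a i • c i, h⟩ : cycles K p) = ∑ i, a i • ⟨c i, hc i⟩ := by
    ext; simp
  unfold homologyClass
  rw [e]
  simp only [← Submodule.mkQ_apply, map_sum, map_smul]

theorem linearIndependent_basisClass :
    LinearIndependent ℂ (basisClass : (Fin m → Bool) → Homology (qubitComplex m) (2 * m)) := by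
  rw [Fintype.linearIndependent_iff]
  intro a ha
  unfold basisClass at ha
  rw [← homologyClass_sum a basisCycle basisCycle_mem_cycles (Submodule.sum_mem _ fun y _ =>
    Submodule.smul_mem _ _ (basisCycle_mem_cycles y)), homologyClass_eq_zero_iff] at ha
  obtain ⟨f, hf, hf'⟩ := exists_of_mem_boundaries ha
  rw [faceChains_qubitComplex] at hf
  simp only [map_sum, map_smul, extend_basisCycle] at hf'
  exact eq_zero_of_sum_partialCycle_eq_bd hf hf'

theorem span_basisClass : Submodule.span ℂ
    (Set.range (basisClass : (Fin m → Bool) → Homology (qubitComplex m) (2 * m))) = ⊤ := by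
  refine Submodule.eq_top_iff'.2 fun x => ?_
  obtain ⟨c, hc, rfl⟩ := homologyClass_surjective x
  obtain ⟨a, b, hb, hab⟩ := exists_eq_sum_basisChain (faceChains_qubitComplex ▸ extend_mem c)
    (mem_cycles_iff.1 hc)
  have hsum : ∑ y, a y • basisCycle y ∈ cycles (qubitComplex m) (2 * m) :=
    Submodule.sum_mem _ fun y _ => Submodule.smul_mem _ _ (basisCycle_mem_cycles y)
  have hcls : homologyClass (qubitComplex m) c hc = homologyClass _ _ hsum := by
    rw [homologyClass_eq_iff]
    have := congrArg (restrict (qubitComplex m) (2 * m)) hab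
    simp only [restrict_extend, map_add, map_sum, map_smul, restrict_basisChain] at this
    rw [this, add_sub_cancel_left]
    exact restrict_bd_mem_boundaries (faceChains_qubitComplex ▸ hb)
  rw [hcls, homologyClass_sum a basisCycle basisCycle_mem_cycles]
  exact Submodule.sum_mem _ fun y _ => Submodule.smul_mem _ _ (Submodule.subset_span ⟨y, rfl⟩)

/-- The joins of loops have `2 * m` vertices, so in any other degree only the boundary term remains.
-/
theorem mem_boundaries_of_ne {p : ℕ} (hp : p ≠ 2 * m) {c : Chain (qubitComplex m) p}
    (hc : c ∈ cycles (qubitComplex m) p) : c ∈ boundaries (qubitComplex m) p := by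
  obtain ⟨a, b, hb, hab⟩ := exists_eq_sum_basisChain (faceChains_qubitComplex ▸ extend_mem c)
    (mem_cycles_iff.1 hc)
  have := congrArg (restrict (qubitComplex m) p) hab
  have h0 (y : Fin m → Bool) : restrict (qubitComplex m) p (basisChain y) = 0 :=
    restrict_eq_zero (fun s hs => card_eq_of_partialCycle_ne_zero hs) hp
  simp only [restrict_extend, map_add, map_sum, map_smul, h0, smul_zero, Finset.sum_const_zero,
    zero_add] at this
  rw [this]
  exact restrict_bd_mem_boundaries (faceChains_qubitComplex ▸ hb)

theorem subsingleton_homology_qubitComplex {p : ℕ} (hp : p ≠ 2 * m) :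
    Subsingleton (Homology (qubitComplex m) p) := by
  refine subsingleton_of_forall_eq 0 fun x => ?_
  obtain ⟨c, hc, rfl⟩ := homologyClass_surjective x
  exact homologyClass_eq_zero_iff.2 (mem_boundaries_of_ne hp hc)

theorem gadgetMap_homologyClass {p : ℕ} {c : Chain (qubitComplex m) p}
    (hc : c ∈ cycles (qubitComplex m) p) :
    gadgetMap z r p (homologyClass _ c hc) = homologyClass (gadgetComplex z r)
      (push _ _ (outer (QubitVertex m)) p c) (push_mem_cycles (outer_mem_gluedComplex _ _ r) hc) :=
  rfl

theorem extend_push_outer {p : ℕ} (c : Chain (qubitComplex m) p) :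
    extend (gadgetComplex z r) p (push _ _ (outer (QubitVertex m)) p c) =
      outerChain m (extend (qubitComplex m) p c) :=
  extend_push _ (outer_mem_gluedComplex _ _ r) c

/-! ### The effect of the gadget on homology -/

variable [IsStrictTotalOrder (QubitVertex m) r]

theorem gadgetMap_basisClass : gadgetMap z r (2 * m) (basisClass z) = 0 := by
  rw [basisClass, gadgetMap_homologyClass, homologyClass_eq_zero_iff]
  obtain ⟨b, hb, h⟩ := (coneAttachment z r).exists_bd_eq
  rw [← faceChains_gadgetComplex] at hb
  rw [← restrict_extend (push _ _ _ _ _), extend_push_outer, extend_basisCycle, h]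
  exact restrict_bd_mem_boundaries hb

theorem ker_gadgetMap :
    LinearMap.ker (gadgetMap z r (2 * m)) = Submodule.span ℂ {basisClass z} := by
  refine le_antisymm (fun x hx => ?_) ?_
  · obtain ⟨c, hc, rfl⟩ := homologyClass_surjective x
    rw [LinearMap.mem_ker, gadgetMap_homologyClass, homologyClass_eq_zero_iff] at hx
    obtain ⟨f, hf, hcf⟩ := exists_of_mem_boundaries hx
    rw [faceChains_gadgetComplex] at hf
    rw [extend_push_outer] at hcf
    have hadj (u v : QubitVertex m) := gadgetGraph_outer_outer (G := qubitGraph m)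
      (T := basisSet z) (r := r) (u := u) (v := v)
    obtain ⟨a, b, hb, hab⟩ := (coneAttachment z r).exists_of_eq_bd
      (embedChain_mem_cliqueChains _ hadj (faceChains_qubitComplex ▸ extend_mem c)) hf hcf
    obtain ⟨b, hb', rfl⟩ := exists_embedChain_eq _ hadj hb
    rw [bd_embedChain, ← map_smul, ← map_add] at hab
    have h := congrArg (restrict (qubitComplex m) (2 * m)) (embedChain_injective _ hab)
    simp only [restrict_extend, map_add, map_smul, restrict_basisChain] at h
    refine Submodule.mem_span_singleton.2 ⟨a, ?_⟩
    refine Eq.symm ((homologyClass_eq_iff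
      (hc' := Submodule.smul_mem _ a (basisCycle_mem_cycles z))).2 ?_)
    rw [h, add_sub_cancel_left]
    exact restrict_bd_mem_boundaries (faceChains_qubitComplex ▸ hb')
  · rw [Submodule.span_singleton_le_iff_mem]
    exact gadgetMap_basisClass z r

theorem gadgetMap_surjective (p : ℕ) : Function.Surjective (gadgetMap z r p) := by
  intro x
  obtain ⟨c, hc, rfl⟩ := homologyClass_surjective x
  have hadj (u v : QubitVertex m) := gadgetGraph_outer_outer (G := qubitGraph m)
    (T := basisSet z) (r := r) (u := u) (v := v)
  obtain ⟨a, ha, ha0, b, hb, hab⟩ := (coneAttachment z r).exists_eq_add_bd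
    (faceChains_gadgetComplex z r ▸ extend_mem c) (mem_cycles_iff.1 hc)
  obtain ⟨a, ha', rfl⟩ := exists_embedChain_eq _ hadj ha
  rw [bd_embedChain, map_eq_zero_iff _ (embedChain_injective _)] at ha0
  rw [← faceChains_qubitComplex] at ha'
  rw [← faceChains_gadgetComplex] at hb
  refine ⟨homologyClass _ _ (restrict_mem_cycles ha' ha0), ?_⟩
  rw [gadgetMap_homologyClass, eq_comm, homologyClass_eq_iff, ← restrict_embedChain _ ha']
  have h := congrArg (restrict (gadgetComplex z r) p) hab
  rw [restrict_extend, map_add] at h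
  rw [h, add_sub_cancel_left]
  exact restrict_bd_mem_boundaries hb

theorem subsingleton_homology_gadgetComplex {p : ℕ} (hp : p ≠ 2 * m) :
    Subsingleton (Homology (gadgetComplex z r) p) := by
  have := subsingleton_homology_qubitComplex hp
  exact (gadgetMap_surjective z r p).subsingleton

/-- The kernel is the line of the class of `z`, which meets the span of the other basis classes
trivially. -/
theorem linearIndependent_gadgetMap_basisClass : LinearIndependent ℂ
    fun y : {y : Fin m → Bool // y ≠ z} => gadgetMap z r (2 * m) (basisClass y.1) := by
  refine (linearIndependent_basisClass.comp _ Subtype.val_injective).map ?_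
  rw [ker_gadgetMap]
  have h := linearIndependent_basisClass.disjoint_span_image
    (s := {y : Fin m → Bool | y ≠ z}) (t := {z}) (by simp)
  rw [Set.image_singleton] at h
  have hset : Set.range (basisClass ∘ ((↑) : {y : Fin m → Bool // y ≠ z} → Fin m → Bool)) =
      basisClass '' {y | y ≠ z} := by
    rw [Set.range_comp, Subtype.range_coe_subtype]
  rw [hset]
  exact h

theorem span_gadgetMap_basisClass : Submodule.span ℂ (Set.range
    fun y : {y : Fin m → Bool // y ≠ z} => gadgetMap z r (2 * m) (basisClass y.1)) = ⊤ := by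
  rw [eq_top_iff, ← LinearMap.range_eq_top.2 (gadgetMap_surjective z r (2 * m)),
    ← Submodule.map_top, ← span_basisClass, Submodule.map_span, Submodule.span_le]
  rintro _ ⟨_, ⟨y, rfl⟩, rfl⟩
  by_cases hy : y = z
  · subst hy
    rw [gadgetMap_basisClass]
    exact Submodule.zero_mem _
  · exact Submodule.subset_span ⟨⟨y, hy⟩, rfl⟩

theorem finrank_homology_gadgetComplex :
    (Module.finrank ℂ (Homology (gadgetComplex z r) (2 * m)) : ℤ) = 2 ^ m - 1 := by
  rw [Module.finrank_eq_card_basis (Module.Basis.mk (linearIndependent_gadgetMap_basisClass z r)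
    (span_gadgetMap_basisClass z r).ge), Fintype.card_subtype_compl, Fintype.card_subtype_eq]
  simp

theorem reducedEulerChar_gadgetComplex : reducedEulerChar (gadgetComplex z r) = -(2 ^ m - 1) := by
  rw [← neg_eq_iff_eq_neg, ← sum_finrank_homology, Finset.sum_eq_single (2 * m)]
  · rw [finrank_homology_gadgetComplex]; simp
  · intro p _ hp
    have := subsingleton_homology_gadgetComplex z r hp
    rw [Module.finrank_zero_of_subsingleton]; simp
  -- The degree `2 * m` lies in the range of summation, since the outer layer alone has `7 * m`
  -- vertices.
  · intro h
    refine (h (Finset.mem_range.2 ?_)).elim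
    have h1 := Nat.card_le_card_of_injective _ (outer (QubitVertex m)).injective
    have h2 : Nat.card (QubitVertex m) = m * 7 := by
      change Nat.card (Fin m × Fin 7) = _
      simp
    omega

end Gadget

end CliqueGadget

end

theorem mainTheorem5 (m : ℕ) (z : Fin m → Bool)
    (r : QubitVertex m → QubitVertex m → Prop) [IsStrictTotalOrder (QubitVertex m) r]
    (lam : ℝ) (hlam : 0 < lam) :
    -- the glued complex is a clique complex
    (∃ S G, gadgetComplex z r = cliqueComplexOn S G) ∧
    (∃ hc : ∀ y : Fin m → Bool, basisCycle y ∈ cycles (qubitComplex m) (2 * m),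
      -- the cycle of `z` is a hole before gluing, and it is filled in by the gadget
      homologyClass (qubitComplex m) (basisCycle z) (hc z) ≠ 0 ∧
      gadgetMap z r (2 * m) (homologyClass (qubitComplex m) (basisCycle z) (hc z)) = 0 ∧
      -- no other hole is filled in
      LinearMap.ker (gadgetMap z r (2 * m)) =
        Submodule.span ℂ {homologyClass (qubitComplex m) (basisCycle z) (hc z)} ∧
      (∀ p, p ≠ 2 * m → Function.Injective (gadgetMap z r p)) ∧
      -- no new homology class is created
      (∀ p, Function.Surjective (gadgetMap z r p)) ∧
      -- the remaining classes are exactly those of the other computational basis states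
      LinearIndependent ℂ (fun y : {y : Fin m → Bool // y ≠ z} =>
        gadgetMap z r (2 * m) (homologyClass (qubitComplex m) (basisCycle y.1) (hc y.1))) ∧
      Submodule.span ℂ (Set.range fun y : {y : Fin m → Bool // y ≠ z} =>
        gadgetMap z r (2 * m) (homologyClass (qubitComplex m) (basisCycle y.1) (hc y.1))) = ⊤ ∧
      (∀ p, p ≠ 2 * m → Subsingleton (Homology (gadgetComplex z r) p))) ∧
    -- Witten index and reduced Euler characteristic
    wittenIndex (gadgetComplex z r) (gadgetWeight (QubitVertex m) lam) = 2 ^ m - 1 ∧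
    reducedEulerChar (gadgetComplex z r) = -(2 ^ m - 1) := by
  refine ⟨⟨_, _, gadgetComplex_eq z r⟩, ⟨basisCycle_mem_cycles,
    linearIndependent_basisClass.ne_zero z, gadgetMap_basisClass z r, ker_gadgetMap z r,
    fun p hp => ?_, gadgetMap_surjective z r, linearIndependent_gadgetMap_basisClass z r,
    span_gadgetMap_basisClass z r, fun p => subsingleton_homology_gadgetComplex z r⟩, ?_,
    reducedEulerChar_gadgetComplex z r⟩
  · have := subsingleton_homology_qubitComplex hp
    exact Function.injective_of_subsingleton _
  · rw [wittenIndex_eq, reducedEulerChar_gadgetComplex, neg_neg]
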